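/- **Theorem (statistical error estimate).** *Data.* Let $n\ge 1$, let $\Omega\subset\mathbb R^n$ be a non-empty bounded open set (for instance a bounded Lipschitz domain) and let $C_\Omega\ge 1$ satisfy $|x|\le C_\Omega$ for $x\in\Omega$. Let $f,\psi\colon\Omega\to\mathbb R$ be continuous and bounded, $k\ge 0$, $\gamma>0$, $w_{o_1},w_{o_2}\ge 0$. Let $\eta,\bar h\in C^1(\bar\Omega)$ with $\eta|_{\partial\Omega}=0$. For $u,v\in C^1(\bar\Omega)$ put $$L_\gamma(u,v)=\int_\Omega \nabla u\cdot\nabla(u-v)+ku(u-v)-f(u-v)\,dx-\frac1{2\gamma}\int_\Omega (u-v)^2+|\nabla u-\nabla v|^2\,dx,\qquad R_i(u)=w_{o_i}\int_\Omega|(\psi-u)^+|^2dx ,$$ and let $\hat L_\gamma,\hat R_1,\hat R_2$ be the Monte-Carlo versions, in which each integral $\int_\Omega g\,dx$ is replaced by $\frac{|\Omega|}N\sum_{i=1}^N g(x_i)$. The collocation points $x_1,\dots,x_N$ ($N\ge1$) are independent and uniformly distributed on $\Omega$. *Networks.* Let $\sigma\in C^1(\mathbb R)$ be bounded, with $\sigma$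 and $\sigma'$ Lipschitz with constants $L_\sigma$ and $L_{\sigma'}$. For depth and width parameters $\mathfrak d,\mathfrak w\ge1$, a DRR residual network is $\bar u=T_{\mathfrak d+1}\circ\mathfrak B_{\mathfrak d}\circ\dots\circ\mathfrak B_1\circ T_0$ with affine maps $T_0\colon\mathbb R^n\to\mathbb R^{\mathfrak w}$, $T_{ij}\colon\mathbb R^{\mathfrak w}\to\mathbb R^{\mathfrak w}$, $T_{\mathfrak d+1}\colon\mathbb R^{\mathfrak w}\to\mathbb R$ and $\mathfrak B_i(z)=\sigma(T_{i2}(\sigma(T_{i1}z)))+z$; it has $\mathfrak m=2\mathfrak d\mathfrak w^2+(n+2\mathfrak d+2)\mathfrak w+1$ parameters. An FFN network is $\bar u=T_{\mathfrak d+1}\circ\sigma\circ T_{\mathfrak d}\circ\sigma\circ\dots\circ T_1\circ\sigma\circ T_0$ with affine $T_0\colon\mathbb R^n\to\mathbb R^{\mathfrak w}$, $T_i\colon\mathbb R^{\mathfrak w}\to\mathbb R^{\mathfrak w}$ ($1\le i\le\mathfrak d$), $T_{\mathfrak d+1}\colon\mathbb R^{\mathfrak w}\to\mathbb R$; it has $\mathfrak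 m'=\mathfrak d\mathfrak w^2+(n+\mathfrak d+2)\mathfrak w+1$ parameters. Let $\Theta^{\mathfrak s},\Theta^{\mathfrak t}$ be sets of parameters of one of the two architectures, all of whose entries are at most $B_\theta$ in absolute value, and let $\mathcal F^{\mathfrak s},\mathcal F^{\mathfrak t}$ be the sets of functions $\bar u\,\eta+\bar h$, where $\bar u$ is a network of that architecture with parameters in $\Theta^{\mathfrak s}$, respectively $\Theta^{\mathfrak t}$. Put $\bar C=\max(1,\|\sigma\|_{L^\infty(\mathbb R)},\|\sigma'\|_{L^\infty(\mathbb R)},L_\sigma,L_{\sigma'},B_\theta)$. *Constants.* Let $M$ be a common upper bound for $|\Omega|$, $k$, $1/\gamma$, $w_{o_1}$, $w_{o_2}$, $\sup_\Omega|f|$, $\sup_\Omega|\psi|$, $\sup_\Omega|\eta|$ and $\sup_\Omega|\nabla\eta|$. Assume that either $M$ also bounds $\sup_\Omega|\bar h|$ and $\sup_\Omega|\nabla\bar h|$, or $\bar h$ coincides on $\bar\Omega$ with a network of the same architecture, depth, width and activation, with parameters bounded by $B_\theta$. In the DRR case let $M$ also bound $\sup_{x\in\Omega}|x|$. *Claim.*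 There is a constant $K>0$ depending only on $M$ (so not on $n$, $\mathfrak d$, $\mathfrak w$, $\sigma$, $B_\theta$, $C_\Omega$ or $N$) such that, in the DRR case, $$\mathbb E_{\{x_i\}}\Big[\sup_{u\in\mathcal F^{\mathfrak s},\,v\in\mathcal F^{\mathfrak t}}\big|L_\gamma(u,v)+R_1(u)-R_2(v)-(\hat L_\gamma(u,v)+\hat R_1(u)-\hat R_2(v))\big|\Big]\le \frac{K\,n^{3/2}\,\mathfrak m\,\sqrt{\sum_{j=0}^{2\mathfrak d}2^j}\;2^{\frac{9\mathfrak d-2}2}\,\mathfrak w^{7\mathfrak d+3}\,\bar C^{14\mathfrak d+9}\sqrt{C_\Omega}}{N^{1/4}},$$ and, in the FFN case, the same expectation is at most $$\frac{K\,n^{3/2}\,\mathfrak m'\,\sqrt{\sum_{j=0}^{\mathfrak d}2^j}\;2^{\frac{9\mathfrak d-4}4}\,\mathfrak w^{\frac{7\mathfrak d}2+3}\,\bar C^{7\mathfrak d+9}\sqrt{C_\Omega}}{N^{1/4}}.$$ In both cases the supremum is a measurable function of $(x_1,\dots,x_N)$ up to null sets. -/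

import Mathlib

open MeasureTheory
open scoped ENNReal NNReal Matrix Gradient

noncomputable section

namespace ObstacleNN

/-- Euclidean space `ℝⁿ`. -/
abbrev E (n : ℕ) : Type := EuclideanSpace ℝ (Fin n)

/-! ### Network architectures -/

/-- The learnable parameters of a deep Ritz residual network with `d` blocks and width `w`.
The index `j : Fin 2` distinguishes the two affine maps inside a block. -/
structure DRRParam (n d w : ℕ) where
  A₀ : Matrix (Fin w) (Fin n) ℝ
  b₀ : Fin w → ℝ
  A : Fin d → Fin 2 → Matrix (Fin w) (Fin w) ℝ
  b : Fin d → Fin 2 → Fin w → ℝ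
  Aout : Fin w → ℝ
  bout : ℝ

/-- All weights and biases are at most `B` in absolute value. -/
def DRRParam.BoundedBy {n d w : ℕ} (θ : DRRParam n d w) (B : ℝ) : Prop :=
  (∀ q j, |θ.A₀ q j| ≤ B) ∧ (∀ q, |θ.b₀ q| ≤ B) ∧
  (∀ i j q r, |θ.A i j q r| ≤ B) ∧ (∀ i j q, |θ.b i j q| ≤ B) ∧
  (∀ q, |θ.Aout q| ≤ B) ∧ |θ.bout| ≤ B

/-- The block `z ↦ σ(T₂ (σ (T₁ z))) + z`, with `σ` acting componentwise. -/
def DRRParam.block {n d w : ℕ} (σ : ℝ → ℝ) (θ : DRRParam n d w) (i : Fin d)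
    (z : Fin w → ℝ) : Fin w → ℝ :=
  σ ∘ (θ.A i 1 *ᵥ (σ ∘ (θ.A i 0 *ᵥ z + θ.b i 0)) + θ.b i 1) + z

/-- The network function `x ↦ T_{d+1} (𝔅_d (⋯ 𝔅_1 (T_0 x)))`. -/
def DRRParam.net {n d w : ℕ} (σ : ℝ → ℝ) (θ : DRRParam n d w) (x : E n) : ℝ :=
  θ.Aout ⬝ᵥ Fin.foldl d (fun z i => θ.block σ i z) (θ.A₀ *ᵥ x.ofLp + θ.b₀) + θ.bout

/-- Number of parameters of a residual network. -/
def drrParamCount (n d w : ℕ) : ℕ := 2 * d * w ^ 2 + (n + 2 * d + 2) * w + 1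

/-- The learnable parameters of a feedforward network with depth parameter `d` and width `w`. -/
structure FFNParam (n d w : ℕ) where
  A₀ : Matrix (Fin w) (Fin n) ℝ
  b₀ : Fin w → ℝ
  A : Fin d → Matrix (Fin w) (Fin w) ℝ
  b : Fin d → Fin w → ℝ
  Aout : Fin w → ℝ
  bout : ℝ

/-- All weights and biases are at most `B` in absolute value. -/
def FFNParam.BoundedBy {n d w : ℕ} (θ : FFNParam n d w) (B : ℝ) : Prop :=
  (∀ q j, |θ.A₀ q j| ≤ B) ∧ (∀ q, |θ.b₀ q| ≤ B) ∧
  (∀ i q r, |θ.A i q r| ≤ B) ∧ (∀ i q, |θ.b i q| ≤ B) ∧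
  (∀ q, |θ.Aout q| ≤ B) ∧ |θ.bout| ≤ B

/-- The network function `T_{d+1} ∘ σ ∘ T_d ∘ σ ∘ ⋯ ∘ T_1 ∘ σ ∘ T_0`. -/
def FFNParam.net {n d w : ℕ} (σ : ℝ → ℝ) (θ : FFNParam n d w) (x : E n) : ℝ :=
  θ.Aout ⬝ᵥ Fin.foldl d (fun z i => σ ∘ (θ.A i *ᵥ z + θ.b i))
    (σ ∘ (θ.A₀ *ᵥ x.ofLp + θ.b₀)) + θ.bout

/-- Number of parameters of a feedforward network. -/
def ffnParamCount (n d w : ℕ) : ℕ := d * w ^ 2 + (n + d + 2) * w + 1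

/-! ### Activation function -/

/-- `σ` is `C¹`, bounded, and `σ`, `σ'` are Lipschitz with constants `L`, `L'`
(so `σ'` is bounded too). -/
structure IsActivation (σ : ℝ → ℝ) (L L' : ℝ≥0) : Prop where
  contDiff : ContDiff ℝ 1 σ
  bounded : ∃ S : ℝ, ∀ t, |σ t| ≤ S
  lipschitz : LipschitzWith L σ
  lipschitz_deriv : LipschitzWith L' (deriv σ)

/-- `C̄ = max(1, ‖σ‖_∞, ‖σ'‖_∞, L, L', B)`. -/
def cBar (σ : ℝ → ℝ) (L L' : ℝ≥0) (B : ℝ) : ℝ :=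
  max 1 (max (⨆ t, |σ t|) (max (⨆ t, |deriv σ t|) (max (L : ℝ) (max (L' : ℝ) B))))

/-! ### Function spaces and the problem data -/

/-- `u ∈ C¹(Ω̄)`: `u` is `C¹` in the open set `Ω`, and `u` and its gradient extend continuously
to the closure. -/
def IsC1Closure {n : ℕ} (Ω : Set (E n)) (u : E n → ℝ) : Prop :=
  ContinuousOn u (closure Ω) ∧ ContDiffOn ℝ 1 u Ω ∧
    ∃ g : E n → E n, ContinuousOn g (closure Ω) ∧ ∀ x ∈ Ω, ∇ u x = g x

/-- `u` and its gradient are bounded by `M` on `Ω`. -/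
def C1BoundedOn {n : ℕ} (Ω : Set (E n)) (M : ℝ) (u : E n → ℝ) : Prop :=
  ∀ x ∈ Ω, |u x| ≤ M ∧ ‖∇ u x‖ ≤ M

/-- Data of the penalised obstacle problem for `-Δ + k Id` on `Ω`: source `f`, obstacle `ψ`,
regularisation parameter `γ` and obstacle penalty weights `w₁`, `w₂`. -/
structure ObstacleProblem (n : ℕ) where
  Ω : Set (E n)
  f : E n → ℝ
  ψ : E n → ℝ
  k : ℝ
  γ : ℝ
  w₁ : ℝ
  w₂ : ℝ

namespace ObstacleProblem

variable {n : ℕ}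

/-- The standing assumptions on the data. -/
structure Admissible (P : ObstacleProblem n) : Prop where
  isOpen : IsOpen P.Ω
  nonempty : P.Ω.Nonempty
  isBounded : Bornology.IsBounded P.Ω
  continuous_f : ContinuousOn P.f P.Ω
  continuous_ψ : ContinuousOn P.ψ P.Ω
  k_nonneg : 0 ≤ P.k
  γ_pos : 0 < P.γ
  w₁_nonneg : 0 ≤ P.w₁
  w₂_nonneg : 0 ≤ P.w₂

/-- `|Ω|`, `k`, `1/γ`, the penalty weights, `sup_Ω |f|` and `sup_Ω |ψ|` are at most `M`. -/
structure BoundedBy (P : ObstacleProblem n) (M : ℝ) : Prop where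
  volume_le : (volume P.Ω).toReal ≤ M
  k_le : P.k ≤ M
  γ_inv_le : 1 / P.γ ≤ M
  w₁_le : P.w₁ ≤ M
  w₂_le : P.w₂ ≤ M
  f_le : ∀ x ∈ P.Ω, |P.f x| ≤ M
  ψ_le : ∀ x ∈ P.Ω, |P.ψ x| ≤ M

/-- `L(u,v) = ⟨Au - f, u - v⟩` with `A = -Δ + k Id`. -/
def loss (P : ObstacleProblem n) (u v : E n → ℝ) : ℝ :=
  (∫ x in P.Ω, (inner ℝ (∇ u x) (∇ u x - ∇ v x) + P.k * u x * (u x - v x))) -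
    ∫ x in P.Ω, P.f x * (u x - v x)

/-- `L_γ(u,v) = L(u,v) - ‖u - v‖²_{H¹(Ω)} / (2γ)`. -/
def lossReg (P : ObstacleProblem n) (u v : E n → ℝ) : ℝ :=
  P.loss u v - 1 / (2 * P.γ) * ∫ x in P.Ω, ((u x - v x) ^ 2 + ‖∇ u x - ∇ v x‖ ^ 2)

/-- `L_o(u) = ∫_Ω |(ψ - u)⁺|²`. -/
def obstacleLoss (P : ObstacleProblem n) (u : E n → ℝ) : ℝ :=
  ∫ x in P.Ω, (max (P.ψ x - u x) 0) ^ 2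

/-- The continuous objective `L_γ(u,v) + R₁(u) - R₂(v)`, with `Rᵢ = wᵢ L_o`. -/
def objective (P : ObstacleProblem n) (u v : E n → ℝ) : ℝ :=
  P.lossReg u v + P.w₁ * P.obstacleLoss u - P.w₂ * P.obstacleLoss v

/-- Monte-Carlo version of `L` at the collocation points `x`. -/
def lossMC (P : ObstacleProblem n) {N : ℕ} (x : Fin N → E n) (u v : E n → ℝ) : ℝ :=
  (volume P.Ω).toReal / N *
      (∑ i, (inner ℝ (∇ u (x i)) (∇ u (x i) - ∇ v (x i)) +
        P.k * u (x i) * (u (x i) - v (x i)))) -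
    (volume P.Ω).toReal / N * ∑ i, P.f (x i) * (u (x i) - v (x i))

/-- Monte-Carlo version of `L_γ`. -/
def lossRegMC (P : ObstacleProblem n) {N : ℕ} (x : Fin N → E n) (u v : E n → ℝ) : ℝ :=
  P.lossMC x u v - (volume P.Ω).toReal / (2 * P.γ * N) *
    ∑ i, ((u (x i) - v (x i)) ^ 2 + ‖∇ u (x i) - ∇ v (x i)‖ ^ 2)

/-- Monte-Carlo version of `L_o`. -/
def obstacleLossMC (P : ObstacleProblem n) {N : ℕ} (x : Fin N → E n) (u : E n → ℝ) : ℝ :=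
  (volume P.Ω).toReal / N * ∑ i, (max (P.ψ (x i) - u (x i)) 0) ^ 2

/-- The Monte-Carlo objective. -/
def objectiveMC (P : ObstacleProblem n) {N : ℕ} (x : Fin N → E n) (u v : E n → ℝ) : ℝ :=
  P.lossRegMC x u v + P.w₁ * P.obstacleLossMC x u - P.w₂ * P.obstacleLossMC x v

/-- `sup_{u ∈ F, v ∈ G}` of the absolute difference of the two objectives, in `[0,∞]`. -/
def statError (P : ObstacleProblem n) (F G : Set (E n → ℝ)) {N : ℕ} (x : Fin N → E n) : ℝ≥0∞ :=
  ⨆ u ∈ F, ⨆ v ∈ G, ENNReal.ofReal |P.objective u v - P.objectiveMC x u v|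

/-- The joint law of `N` independent points, each uniformly distributed on `Ω`. -/
def sampleLaw (P : ObstacleProblem n) (N : ℕ) : Measure (Fin N → E n) :=
  Measure.pi fun _ => ProbabilityTheory.cond volume P.Ω

end ObstacleProblem

/-- The functions `ū η + h` with `ū` a network (given by `net`) whose parameters lie in `Θ`. -/
def ansatz {n : ℕ} {T : Type} (net : T → E n → ℝ) (Θ : Set T) (η h : E n → ℝ) :
    Set (E n → ℝ) :=
  {u | ∃ θ ∈ Θ, u = fun x => net θ x * η x + h x}

/-! ### The explicit rates -/

/-- The rate for residual networks. -/
def drrRate (n d w : ℕ) (C CΩ : ℝ) (N : ℕ) : ℝ :=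
  (n : ℝ) ^ (3 / 2 : ℝ) * (drrParamCount n d w : ℝ) *
    Real.sqrt (∑ k ∈ Finset.range (2 * d + 1), (2 : ℝ) ^ k) *
    (2 : ℝ) ^ ((9 * (d : ℝ) - 2) / 2) * (w : ℝ) ^ (7 * d + 3) * C ^ (14 * d + 9) *
    Real.sqrt CΩ / (N : ℝ) ^ (1 / 4 : ℝ)

/-- The rate for feedforward networks: there are `d + 2` layers instead of `2 * d + 2`, so `2 * d`
is replaced by `d`. -/
def ffnRate (n d w : ℕ) (C CΩ : ℝ) (N : ℕ) : ℝ :=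
  (n : ℝ) ^ (3 / 2 : ℝ) * (ffnParamCount n d w : ℝ) *
    Real.sqrt (∑ k ∈ Finset.range (d + 1), (2 : ℝ) ^ k) *
    (2 : ℝ) ^ ((9 * (d : ℝ) - 4) / 4) * (w : ℝ) ^ (7 * (d : ℝ) / 2 + 3) * C ^ (7 * d + 9) *
    Real.sqrt CΩ / (N : ℝ) ^ (1 / 4 : ℝ)

end ObstacleNN

end

/-! ### A maximal inequality for empirical means -/

namespace ObstacleNN

open ProbabilityTheory

/-! Up to the factor `|Ω|`, the difference of the two objectives is the deviation of an empirical
mean of the integrand `φ_{u,v}` from its expectation under the uniform law. The statement is thus a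
uniform law of large numbers for a class indexed by pairs of parameter vectors in a cube `[-C,
C]^(2m)`.

Two facts about the class suffice. If `H` bounds the networks in `C¹` and `l` is their Lipschitz
constant from parameters (sup norm) to `C¹`, then `φ` is bounded by a multiple of `H ^ 2`
(`abs_integrand_le`) and moves by at most a multiple of `H * l * ε` when the parameters move by `ε`
(`abs_integrand_sub_le`). For a finite net, Hoeffding's lemma and the sub-Gaussian maximal
inequality bound the expected maximal deviation by `G √(2 log(2|J|) / N)`; passing from the class to
the net costs twice the oscillation (`lintegral_iSup_empirical_le`). A grid gives a net with `log
|J|` of order `m log(C l √N)`, and the choice `ε = 1 / (l √N)` makes the discretisation error of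
order `N^(-1/2)`.

The constants `H` and `l` come from an induction over layers that follows a pair of networks
together with their derivatives (`C1Close`). The Lipschitz constant grows exponentially in the
depth, but enters only through its logarithm: `3 C l ≤ Y ^ 9` with `Y = M n C_Ω (2 w C)^(2d)`. Both
`log Y` and `log √N` are then bounded crudely by `Y √N`. This produces the rate `N^(-1/4)` and the
factor `√C_Ω`; the remaining powers of `w` and `C` come from `H ^ 2` and `√Y` and are compared with
the stated exponents.

In a feedforward network `σ` bounds the first layer, so the size of `Ω` affects only `l`. A residual
network transports `T₀ x` through the skip connections, so `H` depends on `sup |x|`, which is why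
`M` must bound it. -/

/-- Maximal inequality for a finite family of sub-Gaussian random variables. -/
lemma lintegral_abs_le_of_subgaussian {Ω I : Type*} [MeasurableSpace Ω] {μ : Measure Ω}
    [IsProbabilityMeasure μ] (J : Finset I) (hJ : J.Nonempty) (Z : I → Ω → ℝ) (c : ℝ≥0)
    (hc : 0 < c) (hZ : ∀ j ∈ J, HasSubgaussianMGF (Z j) c μ) (F : Ω → ℝ)
    (hF : ∀ᵐ x ∂μ, ∃ j ∈ J, F x ≤ |Z j x|) :
    ∫⁻ x, ENNReal.ofReal (F x) ∂μ ≤ ENNReal.ofReal (√(2 * c * Real.log (2 * J.card))) := by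
  have hcard : (1 : ℝ) ≤ J.card := by exact_mod_cast hJ.card_pos
  have hlog : 0 < Real.log (2 * J.card) := Real.log_pos (by linarith)
  have hc' : (0 : ℝ) < c := by exact_mod_cast hc
  set ℓ := Real.log (2 * J.card) with hℓ
  -- Minimises `ℓ / t + c * t / 2`; both terms are then equal and add up to `√(2 * c * ℓ)`.
  set t : ℝ := √(2 * ℓ / c) with ht
  have ht0 : 0 < t := Real.sqrt_pos.2 (by positivity)
  have ht2 : t ^ 2 = 2 * ℓ / c := Real.sq_sqrt (by positivity)
  set a : ℝ := 2 * J.card * Real.exp (c * t ^ 2 / 2) with ha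
  have ha0 : 0 < a := by positivity
  have hloga : Real.log a = ℓ + c * t ^ 2 / 2 := by
    rw [ha, Real.log_mul (by positivity) (Real.exp_pos _).ne', Real.log_exp]
  -- Instead of Jensen's inequality, `log` is replaced by its tangent at `a`, which dominates the
  -- expectation of the exponential sum: `log y ≤ log a - 1 + y / a`. The majorant `R` is
  -- integrable, so no measurability of `F` is needed.
  set R : Ω → ℝ := fun x =>
    1 / t * (Real.log a - 1 +
      1 / a * ∑ j ∈ J, (Real.exp (t * Z j x) + Real.exp (-t * Z j x))) with hR
  have hint : ∀ j ∈ J, Integrable (fun x => Real.exp (t * Z j x) + Real.exp (-t * Z j x)) μ :=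
    fun j hj => ((hZ j hj).integrable_exp_mul t).add ((hZ j hj).integrable_exp_mul (-t))
  have hsum : Integrable
      (fun x => ∑ j ∈ J, (Real.exp (t * Z j x) + Real.exp (-t * Z j x))) μ :=
    integrable_finsetSum _ hint
  have hRint : Integrable R μ :=
    ((integrable_const _).add (hsum.const_mul _)).const_mul _
  have hle : ∀ j ∈ J, ∀ x, |Z j x| ≤ R x := by
    intro j hj x
    have h1 : Real.exp (t * |Z j x|) ≤
        ∑ j ∈ J, (Real.exp (t * Z j x) + Real.exp (-t * Z j x)) := by
      refine le_trans ?_ (Finset.single_le_sum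
        (f := fun j => Real.exp (t * Z j x) + Real.exp (-t * Z j x))
        (fun i _ => by positivity) hj)
      rcases abs_cases (Z j x) with ⟨h, _⟩ | ⟨h, _⟩ <;> rw [h]
      · linarith [Real.exp_pos (-t * Z j x)]
      · rw [mul_neg, ← neg_mul]; linarith [Real.exp_pos (t * Z j x)]
    have h2 := Real.add_one_le_exp (t * |Z j x| - Real.log a)
    rw [Real.exp_sub, Real.exp_log ha0] at h2
    have h3 : Real.exp (t * |Z j x|) / a ≤
        1 / a * ∑ j ∈ J, (Real.exp (t * Z j x) + Real.exp (-t * Z j x)) := by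
      rw [div_eq_mul_inv, mul_comm, one_div]
      gcongr
    have h4 : |Z j x| = 1 / t * (t * |Z j x|) := by field_simp
    rw [h4]
    simp only [hR]
    gcongr
    linarith
  have hintR : ∫ x, R x ∂μ ≤ √(2 * c * ℓ) := by
    have h1 : ∫ x, ∑ j ∈ J, (Real.exp (t * Z j x) + Real.exp (-t * Z j x)) ∂μ ≤ a := by
      rw [integral_finsetSum _ hint]
      calc _ ≤ ∑ j ∈ J, 2 * Real.exp (c * t ^ 2 / 2) := by
            refine Finset.sum_le_sum fun j hj => ?_
            rw [integral_add ((hZ j hj).integrable_exp_mul t) ((hZ j hj).integrable_exp_mul (-t))]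
            have e1 := (hZ j hj).mgf_le t
            have e2 := (hZ j hj).mgf_le (-t)
            simp only [mgf, even_two.neg_pow] at e1 e2
            linarith
        _ = a := by rw [Finset.sum_const, nsmul_eq_mul, ha]; ring
    have h2 : ∫ x, R x ∂μ = 1 / t * (Real.log a - 1 +
        1 / a * ∫ x, ∑ j ∈ J, (Real.exp (t * Z j x) + Real.exp (-t * Z j x)) ∂μ) := by
      simp only [hR]
      rw [integral_const_mul, integral_add (integrable_const _) (hsum.const_mul _),
        integral_const_mul]
      simp
    have h3 : 1 / a * ∫ x, ∑ j ∈ J, (Real.exp (t * Z j x) + Real.exp (-t * Z j x)) ∂μ ≤ 1 := by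
      rw [one_div, inv_mul_le_iff₀ ha0]; linarith
    have h4 : √(2 * c * ℓ) = 1 / t * (ℓ + c * t ^ 2 / 2) := by
      have : √(2 * c * ℓ) = c * t := by
        rw [ht, show 2 * (c : ℝ) * ℓ = c ^ 2 * (2 * ℓ / c) by field_simp,
          Real.sqrt_mul (by positivity), Real.sqrt_sq hc'.le]
      rw [this]
      have : ℓ = c * t ^ 2 / 2 := by rw [ht2]; field_simp
      rw [this]; field_simp; ring
    rw [h2, h4, hloga]
    refine mul_le_mul_of_nonneg_left ?_ (by positivity)
    linarith
  obtain ⟨j₀, hj₀⟩ := hJ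
  calc _ ≤ ∫⁻ x, ENNReal.ofReal (R x) ∂μ := by
        refine lintegral_mono_ae ?_
        filter_upwards [hF] with x ⟨j, hj, hx⟩
        exact ENNReal.ofReal_le_ofReal (hx.trans (hle j hj x))
    _ = ENNReal.ofReal (∫ x, R x ∂μ) :=
        (ofReal_integral_eq_lintegral_ofReal hRint
          (ae_of_all _ fun x => (abs_nonneg _).trans (hle j₀ hj₀ x))).symm
    _ ≤ _ := ENNReal.ofReal_le_ofReal hintR

/-- Uniform deviation of empirical means over a class with a finite sup-norm net. -/
lemma lintegral_iSup_empirical_le {α I : Type*} [MeasurableSpace α] {μ : Measure α}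
    [IsProbabilityMeasure μ] {S : Set α} (hS : ∀ᵐ x ∂μ, x ∈ S) (φ : I → α → ℝ)
    (hφ : ∀ i, AEMeasurable (φ i) μ) {G : ℝ} (hG : 0 < G) (hφG : ∀ i, ∀ x ∈ S, |φ i x| ≤ G)
    (J : Finset I) {e : ℝ} (he : 0 ≤ e)
    (hJ : ∀ i, ∃ j ∈ J, ∀ x ∈ S, |φ i x - φ j x| ≤ e) {N : ℕ} (hN : 1 ≤ N) :
    ∫⁻ x, (⨆ i, ENNReal.ofReal |∫ y, φ i y ∂μ - (1 / N : ℝ) * ∑ k, φ i (x k)|)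
        ∂(Measure.pi fun _ : Fin N => μ) ≤
      ENNReal.ofReal (2 * e + G * √(2 * Real.log (2 * J.card) / N)) := by
  rcases isEmpty_or_nonempty I with hI | ⟨⟨i₀⟩⟩
  · simp
  have hJne : J.Nonempty := by
    obtain ⟨j, hj, -⟩ := hJ i₀
    exact ⟨j, hj⟩
  have hN0 : (0 : ℝ) < N := by exact_mod_cast hN
  have hint : ∀ i, Integrable (φ i) μ := fun i =>
    Integrable.of_bound (hφ i).aestronglyMeasurable G (hS.mono fun x hx => hφG i x hx)
  set P : Measure (Fin N → α) := Measure.pi fun _ => μ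
  have hSP : ∀ᵐ x ∂P, ∀ k, x k ∈ S :=
    ae_all_iff.2 fun k => (Measure.quasiMeasurePreserving_eval (fun _ : Fin N => μ) k).ae hS
  let Z : I → (Fin N → α) → ℝ := fun i x => ∑ k, (φ i (x k) - ∫ y, φ i y ∂μ)
  -- By Hoeffding's lemma each summand, with values in an interval of length `2 * G`, has variance
  -- proxy `G ^ 2`; independence adds the `N` proxies.
  let c : ℝ≥0 := N * G.toNNReal ^ 2
  have hc : (c : ℝ) = N * G ^ 2 := by simp [c, hG.le]
  have hZ : ∀ i, HasSubgaussianMGF (Z i) c P := by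
    intro i
    have h1 : HasSubgaussianMGF (fun x => φ i x - ∫ y, φ i y ∂μ) ((‖G - -G‖₊ / 2) ^ 2) μ :=
      hasSubgaussianMGF_of_mem_Icc (hφ i) (hS.mono fun x hx => abs_le.1 (hφG i x hx))
    have h2 : iIndepFun (fun (k : Fin N) (x : Fin N → α) => φ i (x k) - ∫ y, φ i y ∂μ) P :=
      iIndepFun_pi (μ := fun _ : Fin N => μ)
        (X := fun _ x => φ i x - ∫ y, φ i y ∂μ) fun _ => (hφ i).sub_const _
    have h3 : ∀ k : Fin N, HasSubgaussianMGF
        (fun x : Fin N → α => φ i (x k) - ∫ y, φ i y ∂μ) ((‖G - -G‖₊ / 2) ^ 2) P := by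
      intro k
      have hmp := measurePreserving_eval (fun _ : Fin N => μ) k
      refine HasSubgaussianMGF.of_map (X := fun x => φ i x - ∫ y, φ i y ∂μ)
        (Y := Function.eval k) hmp.aemeasurable ?_
      rw [hmp.map_eq]
      exact h1
    have h4 := HasSubgaussianMGF.sum_of_iIndepFun h2 (s := Finset.univ) fun k _ => h3 k
    convert h4 using 1
    apply NNReal.eq
    rw [hc]
    simp only [Finset.sum_const, Finset.card_univ, Fintype.card_fin, nsmul_eq_mul,
      NNReal.coe_mul, NNReal.coe_natCast, NNReal.coe_pow, NNReal.coe_div, coe_nnnorm]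
    rw [Real.norm_of_nonneg (by linarith)]
    norm_num
  have hdev : ∀ i x, ∫ y, φ i y ∂μ - (1 / N : ℝ) * ∑ k, φ i (x k) = -(1 / N * Z i x) := by
    intro i x
    simp only [Z, Finset.sum_sub_distrib, Finset.sum_const, Finset.card_univ, Fintype.card_fin,
      nsmul_eq_mul]
    field_simp
    ring
  have hmax : ∀ x, ∃ j ∈ J, ∀ i ∈ J, |Z i x| ≤ |Z j x| := fun x =>
    J.exists_max_image (fun j => |Z j x|) hJne
  choose j hjJ hjmax using hmax
  -- Replacing `i` by a net point changes the expectation by at most `e` and the empirical mean by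
  -- at most `e`, whence `2 * e`.
  have hbound : ∀ᵐ x ∂P, (⨆ i, ENNReal.ofReal |∫ y, φ i y ∂μ - (1 / N : ℝ) * ∑ k, φ i (x k)|) ≤
      ENNReal.ofReal (2 * e) + ENNReal.ofReal (1 / N) * ENNReal.ofReal |Z (j x) x| := by
    filter_upwards [hSP] with x hx
    refine iSup_le fun i => ?_
    obtain ⟨i', hi', hii'⟩ := hJ i
    rw [← ENNReal.ofReal_mul (by positivity), ← ENNReal.ofReal_add (by linarith) (by positivity)]
    refine ENNReal.ofReal_le_ofReal ?_
    rw [hdev, abs_neg, abs_mul, abs_of_pos (by positivity)]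
    have h1 : |∫ y, φ i y ∂μ - ∫ y, φ i' y ∂μ| ≤ e := by
      rw [← integral_sub (hint i) (hint i')]
      have := norm_integral_le_of_norm_le_const (μ := μ) (f := fun y => φ i y - φ i' y) (C := e)
        (hS.mono fun y hy => hii' y hy)
      simpa using this
    have h2 : |Z i x - Z i' x| ≤ N * (2 * e) := by
      have : Z i x - Z i' x =
          ∑ k, ((φ i (x k) - φ i' (x k)) - (∫ y, φ i y ∂μ - ∫ y, φ i' y ∂μ)) := by
        simp only [Z, ← Finset.sum_sub_distrib]
        exact Finset.sum_congr rfl fun k _ => by ring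
      rw [this]
      refine (Finset.abs_sum_le_sum_abs _ _).trans ?_
      refine (Finset.sum_le_card_nsmul _ _ (2 * e) fun k _ => ?_).trans (by simp)
      refine (abs_sub _ _).trans ?_
      linarith [hii' _ (hx k)]
    have h3 : |Z i x| ≤ N * (2 * e) + |Z (j x) x| := by
      have := abs_sub_abs_le_abs_sub (Z i x) (Z i' x)
      linarith [hjmax x i' hi']
    calc 1 / N * |Z i x| ≤ 1 / N * (N * (2 * e) + |Z (j x) x|) := by gcongr
      _ = _ := by field_simp
  have hmaxle := lintegral_abs_le_of_subgaussian J hJne Z c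
    (by rw [← NNReal.coe_pos, hc]; positivity) (fun i _ => hZ i) (fun x => |Z (j x) x|)
    (ae_of_all _ fun x => ⟨j x, hjJ x, le_rfl⟩)
  have hcard : (1 : ℝ) ≤ J.card := by exact_mod_cast hJne.card_pos
  have hlog : 0 ≤ Real.log (2 * J.card) := Real.log_nonneg (by linarith)
  calc _ ≤ ∫⁻ x, (ENNReal.ofReal (2 * e) +
          ENNReal.ofReal (1 / N) * ENNReal.ofReal |Z (j x) x|) ∂P := lintegral_mono_ae hbound
    _ = ENNReal.ofReal (2 * e) +
          ENNReal.ofReal (1 / N) * ∫⁻ x, ENNReal.ofReal |Z (j x) x| ∂P := by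
        rw [lintegral_add_left measurable_const, lintegral_const_mul' _ _ ENNReal.ofReal_ne_top]
        simp
    _ ≤ ENNReal.ofReal (2 * e) + ENNReal.ofReal (1 / N) *
          ENNReal.ofReal (√(2 * c * Real.log (2 * J.card))) := by gcongr
    _ = _ := by
        rw [← ENNReal.ofReal_mul (by positivity), ← ENNReal.ofReal_add (by linarith)
          (by positivity)]
        congr 2
        rw [hc, show 2 * (N * G ^ 2) * Real.log (2 * J.card) =
            (N * G) ^ 2 * (2 * Real.log (2 * J.card) / N) by field_simp,
          Real.sqrt_mul (by positivity), Real.sqrt_sq (by positivity)]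
        field_simp

/-! ### Finite nets in parameter space -/

/-- A subset of the cube `[-C, C]^κ` has an `ε`-net in the sup norm of at most
`(⌊2C/ε⌋ + 1)^|κ|` elements. -/
lemma exists_finset_net {I κ : Type*} [Fintype κ] (emb : I → κ → ℝ) {C ε : ℝ}
    (hε : 0 < ε) (hemb : ∀ i k, |emb i k| ≤ C) :
    ∃ J : Finset I, J.card ≤ (⌊2 * C / ε⌋₊ + 1) ^ Fintype.card κ ∧
      ∀ i, ∃ j ∈ J, ∀ k, |emb i k - emb j k| ≤ ε := by
  classical
  have hnn : ∀ i k, 0 ≤ (emb i k + C) / ε := fun i k =>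
    div_nonneg (by linarith [(abs_le.1 (hemb i k)).1]) hε.le
  -- Cells of side `ε`, counted from the corner `-C`: two points of the same cell differ by at most
  -- `ε` in each coordinate.
  let cell : I → κ → Fin (⌊2 * C / ε⌋₊ + 1) := fun i k =>
    ⟨⌊(emb i k + C) / ε⌋₊, Nat.lt_succ_of_le (Nat.floor_le_floor
      (div_le_div_of_nonneg_right (by linarith [(abs_le.1 (hemb i k)).2]) hε.le))⟩
  let s : Finset (κ → Fin (⌊2 * C / ε⌋₊ + 1)) := (Set.range cell).toFinset
  rcases isEmpty_or_nonempty I with hI | hI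
  · exact ⟨∅, by simp, fun i => (hI.false i).elim⟩
  -- One member of `I` per occupied cell, so the net lies inside the class and inherits its bounds.
  -- The arbitrary element is never selected, since `s` consists of occupied cells.
  refine ⟨s.image (fun b => if hb : ∃ i, cell i = b then hb.choose else Classical.arbitrary I),
    ?_, fun i => ?_⟩
  · refine Finset.card_image_le.trans ((Finset.card_le_univ _).trans ?_)
    simp
  · have hex : ∃ j, cell j = cell i := ⟨i, rfl⟩
    refine ⟨hex.choose, Finset.mem_image.2 ⟨cell i, by simp [s], by rw [dif_pos hex]⟩, fun k => ?_⟩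
    have h : ⌊(emb hex.choose k + C) / ε⌋₊ = ⌊(emb i k + C) / ε⌋₊ :=
      congrArg Fin.val (congrFun hex.choose_spec k)
    have a1 := Nat.floor_le (hnn i k)
    have a2 := Nat.lt_floor_add_one ((emb i k + C) / ε)
    have b1 := Nat.floor_le (hnn hex.choose k)
    have b2 := Nat.lt_floor_add_one ((emb hex.choose k + C) / ε)
    rw [h] at b1 b2
    have h3 : |(emb i k + C) / ε - (emb hex.choose k + C) / ε| ≤ 1 := by
      rw [abs_le]; constructor <;> linarith
    rwa [← sub_div, abs_div, abs_of_pos hε, div_le_one hε, add_sub_add_right_eq_sub] at h3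

end ObstacleNN

namespace ObstacleNN

/-! ### `C¹` bounds for pairs of functions at a point -/

section C1Close

variable {X : Type*} [NormedAddCommGroup X] [NormedSpace ℝ X]

/-- At the point `x`, the functions `F`, `G` are differentiable, their values and derivatives are
at most `a` and `b`, and their values and derivatives differ by at most `l₀ * ε` and `l₁ * ε`. -/
structure C1Close (x : X) (ε a b l₀ l₁ : ℝ) (F G : X → ℝ) : Prop where
  diff_left : DifferentiableAt ℝ F x
  diff_right : DifferentiableAt ℝ G x
  abs_left : |F x| ≤ a
  abs_right : |G x| ≤ a
  fderiv_left : ‖fderiv ℝ F x‖ ≤ b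
  fderiv_right : ‖fderiv ℝ G x‖ ≤ b
  abs_sub : |F x - G x| ≤ l₀ * ε
  fderiv_sub : ‖fderiv ℝ F x - fderiv ℝ G x‖ ≤ l₁ * ε

variable {x : X} {ε a b l₀ l₁ a' b' l₀' l₁' : ℝ} {F G F' G' : X → ℝ}

lemma C1Close.mono (h : C1Close x ε a b l₀ l₁ F G) (hε : 0 ≤ ε) (ha : a ≤ a') (hb : b ≤ b')
    (h₀ : l₀ ≤ l₀') (h₁ : l₁ ≤ l₁') : C1Close x ε a' b' l₀' l₁' F G where
  diff_left := h.diff_left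
  diff_right := h.diff_right
  abs_left := h.abs_left.trans ha
  abs_right := h.abs_right.trans ha
  fderiv_left := h.fderiv_left.trans hb
  fderiv_right := h.fderiv_right.trans hb
  abs_sub := h.abs_sub.trans (by gcongr)
  fderiv_sub := h.fderiv_sub.trans (by gcongr)

lemma C1Close.congr_bounds (h : C1Close x ε a b l₀ l₁ F G) (ha : a = a') (hb : b = b')
    (h₀ : l₀ = l₀') (h₁ : l₁ = l₁') : C1Close x ε a' b' l₀' l₁' F G := by
  subst ha hb h₀ h₁; exact h

lemma C1Close.nonneg (h : C1Close x ε a b l₀ l₁ F G) : 0 ≤ a ∧ 0 ≤ b :=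
  ⟨(abs_nonneg _).trans h.abs_left, (norm_nonneg _).trans h.fderiv_left⟩

lemma C1Close.add (h : C1Close x ε a b l₀ l₁ F G) (h' : C1Close x ε a' b' l₀' l₁' F' G') :
    C1Close x ε (a + a') (b + b') (l₀ + l₀') (l₁ + l₁')
      (fun y => F y + F' y) (fun y => G y + G' y) where
  diff_left := h.diff_left.add h'.diff_left
  diff_right := h.diff_right.add h'.diff_right
  abs_left := (abs_add_le _ _).trans (add_le_add h.abs_left h'.abs_left)
  abs_right := (abs_add_le _ _).trans (add_le_add h.abs_right h'.abs_right)
  fderiv_left := by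
    rw [fderiv_fun_add h.diff_left h'.diff_left]
    exact (norm_add_le _ _).trans (add_le_add h.fderiv_left h'.fderiv_left)
  fderiv_right := by
    rw [fderiv_fun_add h.diff_right h'.diff_right]
    exact (norm_add_le _ _).trans (add_le_add h.fderiv_right h'.fderiv_right)
  abs_sub := by
    rw [add_sub_add_comm, add_mul]
    exact (abs_add_le _ _).trans (add_le_add h.abs_sub h'.abs_sub)
  fderiv_sub := by
    rw [fderiv_fun_add h.diff_left h'.diff_left, fderiv_fun_add h.diff_right h'.diff_right,
      add_sub_add_comm, add_mul]
    exact (norm_add_le _ _).trans (add_le_add h.fderiv_sub h'.fderiv_sub)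

lemma C1Close.const {c c' C : ℝ} (hc : |c| ≤ C) (hc' : |c'| ≤ C) (hcc : |c - c'| ≤ ε) :
    C1Close x ε C 0 1 0 (fun _ => c) (fun _ => c') where
  diff_left := differentiableAt_const _
  diff_right := differentiableAt_const _
  abs_left := hc
  abs_right := hc'
  fderiv_left := by simp
  fderiv_right := by simp
  abs_sub := by simpa using hcc
  fderiv_sub := by simp

lemma C1Close.refl (hF : DifferentiableAt ℝ F x) (ha : |F x| ≤ a) (hb : ‖fderiv ℝ F x‖ ≤ b) :
    C1Close x ε a b 0 0 F F where
  diff_left := hF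
  diff_right := hF
  abs_left := ha
  abs_right := ha
  fderiv_left := hb
  fderiv_right := hb
  abs_sub := by simp
  fderiv_sub := by simp

/-- Telescoping through `G * F'`: each difference is paired with a bound on the other factor. The
signs of `l₀ * ε` and `l₁ * ε` follow from the norms they bound. -/
lemma C1Close.mul (h : C1Close x ε a b l₀ l₁ F G) (h' : C1Close x ε a' b' l₀' l₁' F' G') :
    C1Close x ε (a * a') (a * b' + b * a') (a * l₀' + l₀ * a')
      (a * l₁' + l₀ * b' + (b * l₀' + l₁ * a'))
      (fun y => F y * F' y) (fun y => G y * G' y) := by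
  obtain ⟨ha, hb⟩ := h.nonneg
  obtain ⟨ha', hb'⟩ := h'.nonneg
  have hl : 0 ≤ l₀ * ε := (abs_nonneg _).trans h.abs_sub
  have hl1 : 0 ≤ l₁ * ε := (norm_nonneg _).trans h.fderiv_sub
  refine ⟨h.diff_left.mul h'.diff_left, h.diff_right.mul h'.diff_right, ?_, ?_, ?_, ?_, ?_, ?_⟩
  · rw [abs_mul]; exact mul_le_mul h.abs_left h'.abs_left (abs_nonneg _) ha
  · rw [abs_mul]; exact mul_le_mul h.abs_right h'.abs_right (abs_nonneg _) ha
  · rw [fderiv_fun_mul h.diff_left h'.diff_left]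
    refine (norm_add_le _ _).trans (add_le_add ?_ ?_)
    · rw [norm_smul]; exact mul_le_mul h.abs_left h'.fderiv_left (norm_nonneg _) ha
    · rw [norm_smul, mul_comm]; exact mul_le_mul h.fderiv_left h'.abs_left (abs_nonneg _) hb
  · rw [fderiv_fun_mul h.diff_right h'.diff_right]
    refine (norm_add_le _ _).trans (add_le_add ?_ ?_)
    · rw [norm_smul]; exact mul_le_mul h.abs_right h'.fderiv_right (norm_nonneg _) ha
    · rw [norm_smul, mul_comm]; exact mul_le_mul h.fderiv_right h'.abs_right (abs_nonneg _) hb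
  · rw [show F x * F' x - G x * G' x = G x * (F' x - G' x) + (F x - G x) * F' x by ring]
    refine (abs_add_le _ _).trans ?_
    rw [abs_mul, abs_mul]
    have e1 := mul_le_mul h.abs_right h'.abs_sub (abs_nonneg _) ha
    have e2 := mul_le_mul h.abs_sub h'.abs_left (abs_nonneg _) hl
    linarith
  · rw [fderiv_fun_mul h.diff_left h'.diff_left, fderiv_fun_mul h.diff_right h'.diff_right,
      show F x • fderiv ℝ F' x + F' x • fderiv ℝ F x - (G x • fderiv ℝ G' x + G' x • fderiv ℝ G x)
        = (G x • (fderiv ℝ F' x - fderiv ℝ G' x) + (F x - G x) • fderiv ℝ F' x) +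
          ((F' x - G' x) • fderiv ℝ G x + F' x • (fderiv ℝ F x - fderiv ℝ G x)) by module]
    refine (norm_add_le _ _).trans ?_
    have e1 := mul_le_mul h.abs_right h'.fderiv_sub (norm_nonneg _) ha
    have e2 := mul_le_mul h.abs_sub h'.fderiv_left (norm_nonneg _) hl
    have e3 := mul_le_mul h.fderiv_right h'.abs_sub (abs_nonneg _) hb
    have e4 := mul_le_mul h.fderiv_sub h'.abs_left (abs_nonneg _) hl1
    have n1 := norm_add_le (G x • (fderiv ℝ F' x - fderiv ℝ G' x)) ((F x - G x) • fderiv ℝ F' x)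
    have n2 := norm_add_le ((F' x - G' x) • fderiv ℝ G x) (F' x • (fderiv ℝ F x - fderiv ℝ G x))
    simp only [norm_smul, Real.norm_eq_abs] at n1 n2
    linarith

lemma C1Close.sum {w : ℕ} {F G : Fin w → X → ℝ} (h : ∀ q, C1Close x ε a b l₀ l₁ (F q) (G q)) :
    C1Close x ε (w * a) (w * b) (w * l₀) (w * l₁) (fun y => ∑ q, F q y) (fun y => ∑ q, G q y) := by
  induction w with
  | zero =>
    simpa using C1Close.refl (ε := ε) (F := fun _ : X => (0 : ℝ)) (x := x) (a := 0) (b := 0)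
      (differentiableAt_const _) (by simp) (by simp)
  | succ w ih =>
    simp only [Fin.sum_univ_castSucc, Nat.cast_succ, add_mul, one_mul]
    exact (ih fun q => h q.castSucc).add (h (Fin.last w))

/-- An affine combination of functions, with perturbed coefficients. -/
lemma C1Close.affine {w : ℕ} {F G : X → Fin w → ℝ} {A A' : Fin w → ℝ} {c c' C : ℝ}
    (h : ∀ q, C1Close x ε a b l₀ l₁ (fun y => F y q) (fun y => G y q))
    (hA : ∀ q, |A q| ≤ C) (hA' : ∀ q, |A' q| ≤ C) (hAA : ∀ q, |A q - A' q| ≤ ε)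
    (hc : |c| ≤ C) (hc' : |c'| ≤ C) (hcc : |c - c'| ≤ ε) :
    C1Close x ε (w * C * a + C) (w * C * b) (w * C * l₀ + w * a + 1) (w * C * l₁ + w * b)
      (fun y => A ⬝ᵥ F y + c) (fun y => A' ⬝ᵥ G y + c') := by
  have := (C1Close.sum fun q =>
    (C1Close.const (x := x) (hA q) (hA' q) (hAA q)).mul (h q)).add (C1Close.const hc hc' hcc)
  exact this.congr_bounds (by ring) (by ring) (by ring) (by ring)

/-! ### Activation functions and one layer of a network -/

/-- `σ` is `C¹`, and `C` bounds `σ`, `σ'` and their Lipschitz constants. -/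
structure ActivationBound (σ : ℝ → ℝ) (C : ℝ) : Prop where
  contDiff : ContDiff ℝ 1 σ
  abs_le : ∀ t, |σ t| ≤ C
  abs_deriv_le : ∀ t, |deriv σ t| ≤ C
  abs_sub_le : ∀ s t, |σ s - σ t| ≤ C * |s - t|
  abs_deriv_sub_le : ∀ s t, |deriv σ s - deriv σ t| ≤ C * |s - t|

lemma ActivationBound.nonneg {σ : ℝ → ℝ} {C : ℝ} (hσ : ActivationBound σ C) : 0 ≤ C :=
  (abs_nonneg _).trans (hσ.abs_le 0)

lemma one_le_cBar (σ : ℝ → ℝ) (L L' : ℝ≥0) (B : ℝ) : 1 ≤ cBar σ L L' B := le_max_left _ _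

lemma le_cBar (σ : ℝ → ℝ) (L L' : ℝ≥0) (B : ℝ) : B ≤ cBar σ L L' B := by simp [cBar]

lemma IsActivation.activationBound {σ : ℝ → ℝ} {L L' : ℝ≥0} (h : IsActivation σ L L') (B : ℝ) :
    ActivationBound σ (cBar σ L L' B) := by
  have hL : (L : ℝ) ≤ cBar σ L L' B := by simp [cBar]
  have hL' : (L' : ℝ) ≤ cBar σ L L' B := by simp [cBar]
  refine ⟨h.contDiff, fun t => ?_, fun t => ?_, fun s t => ?_, fun s t => ?_⟩
  -- Boundedness is essential here: a real supremum over an unbounded family takes the default value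
  -- `0`.
  · obtain ⟨S, hS⟩ := h.bounded
    have : |σ t| ≤ ⨆ t, |σ t| := le_ciSup (f := fun t => |σ t|) ⟨S, by rintro _ ⟨t, rfl⟩; exact hS t⟩ t
    exact this.trans (by simp [cBar])
  · exact (norm_deriv_le_of_lipschitz h.lipschitz).trans hL
  · exact (h.lipschitz.dist_le_mul s t).trans (by rw [Real.dist_eq]; gcongr)
  · exact (h.lipschitz_deriv.dist_le_mul s t).trans (by rw [Real.dist_eq]; gcongr)

/-- Values are reset to the bound `C` of `σ`. In the difference of derivatives, `σ'(F) - σ'(G)`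
multiplies a derivative; this gives the quadratic term `C * l₀ * b`, and it is where `σ'` must be
Lipschitz. -/
lemma C1Close.comp {σ : ℝ → ℝ} {C : ℝ} (hσ : ActivationBound σ C)
    (h : C1Close x ε a b l₀ l₁ F G) :
    C1Close x ε C (C * b) (C * l₀) (C * l₁ + C * l₀ * b)
      (fun y => σ (F y)) (fun y => σ (G y)) := by
  have hC := hσ.nonneg
  have hσd : Differentiable ℝ σ := hσ.contDiff.differentiable one_ne_zero
  obtain ⟨ha, hb⟩ := h.nonneg
  have hF : HasFDerivAt (fun y => σ (F y)) (deriv σ (F x) • fderiv ℝ F x) x :=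
    (hσd _).hasDerivAt.comp_hasFDerivAt x h.diff_left.hasFDerivAt
  have hG : HasFDerivAt (fun y => σ (G y)) (deriv σ (G x) • fderiv ℝ G x) x :=
    (hσd _).hasDerivAt.comp_hasFDerivAt x h.diff_right.hasFDerivAt
  refine ⟨hF.differentiableAt, hG.differentiableAt, hσ.abs_le _, hσ.abs_le _, ?_, ?_, ?_, ?_⟩
  · rw [hF.fderiv, norm_smul]
    exact mul_le_mul (hσ.abs_deriv_le _) h.fderiv_left (norm_nonneg _) hC
  · rw [hG.fderiv, norm_smul]
    exact mul_le_mul (hσ.abs_deriv_le _) h.fderiv_right (norm_nonneg _) hC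
  · refine (hσ.abs_sub_le _ _).trans ?_
    rw [mul_assoc]
    exact mul_le_mul_of_nonneg_left h.abs_sub hC
  · rw [hF.fderiv, hG.fderiv, show deriv σ (F x) • fderiv ℝ F x - deriv σ (G x) • fderiv ℝ G x =
      deriv σ (F x) • (fderiv ℝ F x - fderiv ℝ G x) +
        (deriv σ (F x) - deriv σ (G x)) • fderiv ℝ G x by module]
    refine (norm_add_le _ _).trans ?_
    rw [norm_smul, norm_smul]
    have e1 := mul_le_mul (hσ.abs_deriv_le (F x)) h.fderiv_sub (norm_nonneg _) hC
    have e2 := mul_le_mul ((hσ.abs_deriv_sub_le (F x) (G x)).trans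
      (mul_le_mul_of_nonneg_left h.abs_sub hC)) h.fderiv_right (norm_nonneg _)
      (mul_nonneg hC ((abs_nonneg _).trans h.abs_sub))
    simp only [Real.norm_eq_abs] at *
    linarith

/-- One layer `σ ∘ affine`: exact bounds on values and derivatives, crude bounds `m`, `s` on the
Lipschitz constants. -/
lemma C1Close.layer {σ : ℝ → ℝ} {C : ℝ} (hσ : ActivationBound σ C) (hC : 1 ≤ C) (hε : 0 ≤ ε)
    {w : ℕ} (hw : 1 ≤ w) {m s : ℝ} (ham : a ≤ m) (hbm : b ≤ m) (hm : 1 ≤ m) (hms : m ^ 2 ≤ s)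
    {F G : X → Fin w → ℝ} {A A' : Matrix (Fin w) (Fin w) ℝ} {c c' : Fin w → ℝ}
    (h : ∀ q, C1Close x ε a b m s (fun y => F y q) (fun y => G y q))
    (hA : ∀ q r, |A q r| ≤ C) (hA' : ∀ q r, |A' q r| ≤ C) (hAA : ∀ q r, |A q r - A' q r| ≤ ε)
    (hc : ∀ q, |c q| ≤ C) (hc' : ∀ q, |c' q| ≤ C) (hcc : ∀ q, |c q - c' q| ≤ ε) (q : Fin w) :
    C1Close x ε C (w * C ^ 2 * b) (3 * w * C ^ 2 * m) (2 * (3 * w * C ^ 2) ^ 2 * s)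
      (fun y => (σ ∘ (A *ᵥ F y + c)) q) (fun y => (σ ∘ (A' *ᵥ G y + c')) q) := by
  have hW : (1 : ℝ) ≤ w := by exact_mod_cast hw
  obtain ⟨ha, hb⟩ := (h q).nonneg
  have hWC : 1 ≤ w * C := one_le_mul_of_one_le_of_one_le hW hC
  have hWC2 : 1 ≤ w * C ^ 2 := one_le_mul_of_one_le_of_one_le hW (one_le_pow₀ hC)
  have hm2 : m ≤ m ^ 2 := by nlinarith
  have hl : w * C * m + w * a + 1 ≤ 3 * (w * C) * m := by
    have e1 : w * a ≤ w * C * m := by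
      rw [mul_assoc]
      exact mul_le_mul_of_nonneg_left (ham.trans (le_mul_of_one_le_left (by linarith) hC))
        (by linarith)
    have e2 : 1 ≤ w * C * m := one_le_mul_of_one_le_of_one_le hWC hm
    linarith
  refine (C1Close.comp hσ
    (C1Close.affine h (hA q) (hA' q) (hAA q) (hc q) (hc' q) (hcc q))).mono hε le_rfl
    (by linarith) ?_ ?_
  · calc C * (w * C * m + w * a + 1) ≤ C * (3 * (w * C) * m) := by gcongr
      _ = _ := by ring
  -- The quadratic term is why `s` must dominate `m ^ 2`. The two parts contribute `2` and `3` times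
  -- `(w * C ^ 2) ^ 2 * s`, within the allowed `18`.
  · have e1 : C * (w * C * s + w * b) ≤ 2 * (w * C ^ 2) ^ 2 * s := by
      have f1 : w * b ≤ w * C * s := by
        rw [mul_assoc]
        refine mul_le_mul_of_nonneg_left ((hbm.trans (hm2.trans hms)).trans
          (le_mul_of_one_le_left (by nlinarith) hC)) (by linarith)
      have f2 : C * (w * C * s + w * b) ≤ C * (2 * (w * C * s)) := by gcongr; linarith
      have f3 : w * C ^ 2 ≤ (w * C ^ 2) ^ 2 := by nlinarith
      have f4 : 2 * (w * C ^ 2) * s ≤ 2 * (w * C ^ 2) ^ 2 * s := by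
        have : 0 ≤ s := by nlinarith
        gcongr
      linarith
    have e2 : C * (w * C * m + w * a + 1) * (w * C * b) ≤ 3 * (w * C ^ 2) ^ 2 * s := by
      calc C * (w * C * m + w * a + 1) * (w * C * b) ≤ C * (3 * (w * C) * m) * (w * C * m) := by
            gcongr
        _ = 3 * (w ^ 2 * C ^ 3) * m ^ 2 := by ring
        _ ≤ 3 * (w ^ 2 * C ^ 4) * s := by gcongr; norm_num
        _ = _ := by ring
    have e3 : 0 ≤ (w * C ^ 2) ^ 2 * s := mul_nonneg (sq_nonneg _) (by nlinarith)
    linarith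

end C1Close

/-- An affine functional on Euclidean space. -/
lemma C1Close.affineFunctional {n : ℕ} {x : E n} {ε R C : ℝ} {A A' : Fin n → ℝ} {c c' : ℝ}
    (hε : 0 ≤ ε) (hC : 0 ≤ C) (hx : ‖x‖ ≤ R)
    (hA : ∀ q, |A q| ≤ C) (hA' : ∀ q, |A' q| ≤ C) (hAA : ∀ q, |A q - A' q| ≤ ε)
    (hc : |c| ≤ C) (hc' : |c'| ≤ C) (hcc : |c - c'| ≤ ε) :
    C1Close x ε (√n * C * R + C) (√n * C) (√n * R + 1) √n
      (fun y : E n => A ⬝ᵥ y.ofLp + c) (fun y => A' ⬝ᵥ y.ofLp + c') := by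
  have hR : 0 ≤ R := (norm_nonneg _).trans hx
  -- The factor `√n` is the price of bounding a Euclidean norm by the largest entry.
  have key : ∀ (D : ℝ) (A : Fin n → ℝ), 0 ≤ D → (∀ q, |A q| ≤ D) →
      ‖innerSL ℝ (WithLp.toLp 2 A : E n)‖ ≤ √n * D := by
    intro D A hD hA
    rw [innerSL_apply_norm, EuclideanSpace.norm_eq]
    calc √(∑ i, ‖A i‖ ^ 2) ≤ √(∑ _i : Fin n, D ^ 2) := by
          gcongr with i; exact hA i
      _ = _ := by simp [Real.sqrt_sq hD]
  have hval : ∀ (A : Fin n → ℝ) (y : E n), A ⬝ᵥ y.ofLp = innerSL ℝ (WithLp.toLp 2 A : E n) y := by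
    intro A y
    simp [innerSL_apply_apply, PiLp.inner_apply, dotProduct, mul_comm]
  simp only [hval]
  have hd : ∀ (A : Fin n → ℝ) (c : ℝ), HasFDerivAt
      (fun y : E n => innerSL ℝ (WithLp.toLp 2 A : E n) y + c) (innerSL ℝ (WithLp.toLp 2 A : E n)) x :=
    fun A c => (ContinuousLinearMap.hasFDerivAt _).add_const c
  have hsub : innerSL ℝ (WithLp.toLp 2 A : E n) - innerSL ℝ (WithLp.toLp 2 A' : E n) =
      innerSL ℝ (WithLp.toLp 2 (A - A') : E n) := by
    rw [← map_sub, WithLp.toLp_sub]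
  have hle : ∀ (D : ℝ) (A : Fin n → ℝ), 0 ≤ D → (∀ q, |A q| ≤ D) →
      |innerSL ℝ (WithLp.toLp 2 A : E n) x| ≤ √n * D * R := by
    intro D A hD hA
    exact (ContinuousLinearMap.le_opNorm _ _).trans
      (mul_le_mul (key D A hD hA) hx (norm_nonneg _) (by positivity))
  refine ⟨(hd A c).differentiableAt, (hd A' c').differentiableAt, ?_, ?_, ?_, ?_, ?_, ?_⟩
  · exact (abs_add_le _ _).trans (add_le_add (hle C A hC hA) hc)
  · exact (abs_add_le _ _).trans (add_le_add (hle C A' hC hA') hc')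
  · rw [(hd A c).fderiv]; exact key C A hC hA
  · rw [(hd A' c').fderiv]; exact key C A' hC hA'
  · rw [add_sub_add_comm, ← _root_.sub_apply, hsub]
    refine (abs_add_le _ _).trans ?_
    linarith [hle ε (A - A') hε hAA]
  · rw [(hd A c).fderiv, (hd A' c').fderiv, hsub]; exact key ε (A - A') hε hAA

/-! ### Networks -/

/-- Induction along the layers of a pair of networks. -/
lemma foldl_induction₂ {X V : Type*} {d : ℕ} (f g : Fin d → V → V)
    (P : ℕ → (X → V) → (X → V) → Prop) {F G : X → V} (h0 : P 0 F G)
    (hstep : ∀ (i : Fin d) (F G : X → V), P i F G →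
      P (i + 1) (fun x => f i (F x)) (fun x => g i (G x))) :
    P d (fun x => Fin.foldl d (fun z i => f i z) (F x))
      (fun x => Fin.foldl d (fun z i => g i z) (G x)) := by
  induction d with
  | zero => simpa using h0
  | succ d ih =>
    simp only [Fin.foldl_succ_last]
    exact hstep (Fin.last d) _ _ (ih (fun i => f i.castSucc) (fun i => g i.castSucc)
      fun i F G h => hstep i.castSucc F G h)

lemma contDiff_affine_layer {X : Type*} [NormedAddCommGroup X] [NormedSpace ℝ X] {σ : ℝ → ℝ}
    (hσ : ContDiff ℝ 1 σ) {v w : ℕ} (A : Matrix (Fin w) (Fin v) ℝ) (b : Fin w → ℝ)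
    {F : X → Fin v → ℝ} (hF : ContDiff ℝ 1 F) :
    ContDiff ℝ 1 (fun x => σ ∘ (A *ᵥ F x + b)) := by
  have hF' := contDiff_pi.1 hF
  refine contDiff_pi.2 fun q => hσ.comp ?_
  simp only [Pi.add_apply, Matrix.mulVec, dotProduct]
  fun_prop

lemma contDiff_affine {X : Type*} [NormedAddCommGroup X] [NormedSpace ℝ X] {v : ℕ}
    (A : Fin v → ℝ) (b : ℝ) {F : X → Fin v → ℝ} (hF : ContDiff ℝ 1 F) :
    ContDiff ℝ 1 (fun x => A ⬝ᵥ F x + b) := by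
  have hF' := contDiff_pi.1 hF
  simp only [dotProduct]
  fun_prop

lemma contDiff_ofLp_one {n : ℕ} : ContDiff ℝ 1 (fun x : E n => x.ofLp) :=
  contDiff_pi.2 fun i => by fun_prop

lemma FFNParam.contDiff_net {n d w : ℕ} {σ : ℝ → ℝ} (hσ : ContDiff ℝ 1 σ)
    (θ : FFNParam n d w) : ContDiff ℝ 1 (θ.net σ) :=
  contDiff_affine _ _ <| foldl_induction₂ (fun i z => σ ∘ (θ.A i *ᵥ z + θ.b i))
    (fun i z => σ ∘ (θ.A i *ᵥ z + θ.b i)) (fun _ F _ => ContDiff ℝ 1 F)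
    (F := fun x : E n => σ ∘ (θ.A₀ *ᵥ x.ofLp + θ.b₀))
    (G := fun x : E n => σ ∘ (θ.A₀ *ᵥ x.ofLp + θ.b₀))
    (contDiff_affine_layer hσ _ _ contDiff_ofLp_one)
    fun _ _ _ hF => contDiff_affine_layer hσ _ _ hF

lemma DRRParam.contDiff_net {n d w : ℕ} {σ : ℝ → ℝ} (hσ : ContDiff ℝ 1 σ)
    (θ : DRRParam n d w) : ContDiff ℝ 1 (θ.net σ) :=
  contDiff_affine _ _ <| foldl_induction₂ (fun i z => θ.block σ i z)
    (fun i z => θ.block σ i z) (fun _ F _ => ContDiff ℝ 1 F)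
    (F := fun x : E n => θ.A₀ *ᵥ x.ofLp + θ.b₀)
    (G := fun x : E n => θ.A₀ *ᵥ x.ofLp + θ.b₀)
    (contDiff_pi.2 fun _ => contDiff_affine _ _ contDiff_ofLp_one)
    fun _ _ _ hF => (contDiff_affine_layer hσ _ _ (contDiff_affine_layer hσ _ _ hF)).add hF

/-! ### Parameter vectors and layerwise bounds for networks -/

/-- The list of all parameters of a residual network. -/
def DRRParam.coord {n d w : ℕ} (θ : DRRParam n d w) :
    (Fin w × Fin n) ⊕ Fin w ⊕ (Fin d × Fin 2 × Fin w × Fin w) ⊕ (Fin d × Fin 2 × Fin w) ⊕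
      Fin w ⊕ Unit → ℝ :=
  Sum.elim (fun p => θ.A₀ p.1 p.2) <| Sum.elim θ.b₀ <|
    Sum.elim (fun p => θ.A p.1 p.2.1 p.2.2.1 p.2.2.2) <|
    Sum.elim (fun p => θ.b p.1 p.2.1 p.2.2) <| Sum.elim θ.Aout fun _ => θ.bout

/-- The list of all parameters of a feedforward network. -/
def FFNParam.coord {n d w : ℕ} (θ : FFNParam n d w) :
    (Fin w × Fin n) ⊕ Fin w ⊕ (Fin d × Fin w × Fin w) ⊕ (Fin d × Fin w) ⊕
      Fin w ⊕ Unit → ℝ :=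
  Sum.elim (fun p => θ.A₀ p.1 p.2) <| Sum.elim θ.b₀ <|
    Sum.elim (fun p => θ.A p.1 p.2.1 p.2.2) <|
    Sum.elim (fun p => θ.b p.1 p.2) <| Sum.elim θ.Aout fun _ => θ.bout

lemma DRRParam.boundedBy_iff {n d w : ℕ} (θ : DRRParam n d w) (B : ℝ) :
    θ.BoundedBy B ↔ ∀ k, |θ.coord k| ≤ B := by
  simp [DRRParam.BoundedBy, DRRParam.coord, Sum.forall, Prod.forall]

lemma FFNParam.boundedBy_iff {n d w : ℕ} (θ : FFNParam n d w) (B : ℝ) :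
    θ.BoundedBy B ↔ ∀ k, |θ.coord k| ≤ B := by
  simp [FFNParam.BoundedBy, FFNParam.coord, Sum.forall, Prod.forall]

/-- The growth scales after `i` residual blocks satisfy the hypotheses of `C1Close.layer`. Values
grow only linearly, since each block adds a term bounded by `C`; this is absorbed by `i + 1 ≤ 2 ^
i`. -/
lemma residual_scale_le {M C t : ℝ} {n w : ℕ} (hn : 1 ≤ √(n : ℝ)) (hM : 1 ≤ M) (hC : 1 ≤ C)
    (hw : 1 ≤ (w : ℝ)) (ht : t = 3 * w * C ^ 2) (i : ℕ) :
    1 ≤ 2 * M * √n * C ∧ 1 ≤ 2 * M * √n * C * (2 * t ^ 2) ^ i ∧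
      (2 * M * √n * C * (2 * t ^ 2) ^ i) ^ 2 ≤ (2 * M * √n * C) ^ 2 * (5 * t ^ 4) ^ i ∧
      C * (2 * M * √n + i) ≤ 2 * M * √n * C * (2 * t ^ 2) ^ i ∧
      √n * C * (2 * w ^ 2 * C ^ 4) ^ i ≤ 2 * M * √n * C * (2 * t ^ 2) ^ i := by
  have hMn : 1 ≤ M * √n := one_le_mul_of_one_le_of_one_le hM hn
  have hWC2 : 1 ≤ w * C ^ 2 := one_le_mul_of_one_le_of_one_le hw (one_le_pow₀ hC)
  have ht3 : 3 ≤ t := by rw [ht]; linarith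
  have ht2 : 1 ≤ t ^ 2 := one_le_pow₀ (by linarith)
  have hMnC : M * √n ≤ M * √n * C := le_mul_of_one_le_right (by linarith) hC
  have hD1 : 1 ≤ 2 * M * √n * C := by linarith
  have h1 : (i : ℝ) + 1 ≤ (2 : ℝ) ^ i := by exact_mod_cast Nat.lt_two_pow_self
  have h2 : (2 : ℝ) ^ i ≤ (2 * t ^ 2) ^ i := by gcongr; linarith
  refine ⟨hD1, one_le_mul_of_one_le_of_one_le hD1 (one_le_pow₀ (by linarith)), ?_, ?_, ?_⟩
  · rw [mul_pow _ ((2 * t ^ 2) ^ i), ← pow_mul, mul_comm i, pow_mul]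
    gcongr
    rw [mul_pow, ← pow_mul]
    gcongr
    norm_num
  · have h3 : C * i ≤ 2 * M * √n * C * i := by
      gcongr; exact le_mul_of_one_le_left (by linarith) (by linarith)
    calc C * (2 * M * √n + i) ≤ 2 * M * √n * C * (i + 1) := by linarith
      _ ≤ _ := by gcongr; linarith
  · have : 2 * (w : ℝ) ^ 2 * C ^ 4 ≤ 2 * t ^ 2 := by
      rw [ht, show 2 * (w : ℝ) ^ 2 * C ^ 4 = 2 * (w * C ^ 2) ^ 2 by ring]
      gcongr
      linarith
    have : √(n : ℝ) ≤ 2 * M * √n := le_mul_of_one_le_left (by linarith) (by linarith)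
    gcongr

/-- `C¹` bounds for the output of the residual blocks. -/
lemma DRRParam.c1Close_blocks {n d w : ℕ} (hn : 1 ≤ n) (hw : 1 ≤ w) {σ : ℝ → ℝ}
    {C M ε r : ℝ} (hσ : ActivationBound σ C) (hC : 1 ≤ C) (hM : 1 ≤ M) (hε : 0 ≤ ε)
    {θ θ' : DRRParam n d w} (hθ : ∀ k, |θ.coord k| ≤ C) (hθ' : ∀ k, |θ'.coord k| ≤ C)
    (hθθ : ∀ k, |θ.coord k - θ'.coord k| ≤ ε) {x : E n} (hx : ‖x‖ ≤ M)
    (hr : r = 3 * w * C ^ 2) (q : Fin w) :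
    C1Close x ε (C * (2 * M * √n + d)) (√n * C * (2 * w ^ 2 * C ^ 4) ^ d)
      (2 * M * √n * C * (2 * r ^ 2) ^ d) ((2 * M * √n * C) ^ 2 * (5 * r ^ 4) ^ d)
      (fun y => Fin.foldl d (fun z i => θ.block σ i z) (θ.A₀ *ᵥ y.ofLp + θ.b₀) q)
      (fun y => Fin.foldl d (fun z i => θ'.block σ i z) (θ'.A₀ *ᵥ y.ofLp + θ'.b₀) q) := by
  simp only [DRRParam.coord, Sum.forall, Prod.forall, Sum.elim_inl, Sum.elim_inr] at hθ hθ' hθθ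
  obtain ⟨p1, p2, p3, p4, p5, p6⟩ := hθ
  obtain ⟨q1, q2, q3, q4, q5, q6⟩ := hθ'
  obtain ⟨e1, e2, e3, e4, e5, e6⟩ := hθθ
  have hW : (1 : ℝ) ≤ w := by exact_mod_cast hw
  have hn' : (1 : ℝ) ≤ √n := Real.one_le_sqrt.2 (by exact_mod_cast hn)
  have hWC2 : 1 ≤ w * C ^ 2 := one_le_mul_of_one_le_of_one_le hW (one_le_pow₀ hC)
  have hr3 : 3 ≤ r := by rw [hr]; linarith
  have hMn : 1 ≤ M * √n := one_le_mul_of_one_le_of_one_le hM hn'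
  have hMnC : M * √n ≤ M * √n * C := le_mul_of_one_le_right (by linarith) hC
  have hnM : √n ≤ M * √n := le_mul_of_one_le_left (by linarith) hM
  have hbase : ∀ q, C1Close x ε (C * (2 * M * √n + (0 : ℕ))) (√n * C * (2 * w ^ 2 * C ^ 4) ^ 0)
      (2 * M * √n * C * (2 * r ^ 2) ^ 0) ((2 * M * √n * C) ^ 2 * (5 * r ^ 4) ^ 0)
      (fun y : E n => (θ.A₀ *ᵥ y.ofLp + θ.b₀) q) (fun y => (θ'.A₀ *ᵥ y.ofLp + θ'.b₀) q) := by
    intro q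
    refine (C1Close.affineFunctional hε (by linarith) hx (p1 q) (q1 q) (e1 q) (p2 q) (q2 q)
      (e2 q)).mono hε ?_ (by simp) ?_ ?_
    · have : C ≤ C * (M * √n) := le_mul_of_one_le_right (by linarith) hMn
      push_cast
      linarith
    · rw [pow_zero, mul_one]; linarith
    · rw [pow_zero, mul_one]
      have : √n ≤ 2 * M * √n * C := by linarith
      nlinarith
  exact foldl_induction₂ (fun i z => θ.block σ i z) (fun i z => θ'.block σ i z)
    (fun i F G => ∀ q, C1Close x ε (C * (2 * M * √n + (i : ℕ))) (√n * C * (2 * w ^ 2 * C ^ 4) ^ i)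
      (2 * M * √n * C * (2 * r ^ 2) ^ i) ((2 * M * √n * C) ^ 2 * (5 * r ^ 4) ^ i)
      (fun y : E n => F y q) (fun y => G y q)) hbase (by
    intro i F G h q
    obtain ⟨-, hm, hms, ham, hbm⟩ := residual_scale_le hn' hM hC hW hr i
    have s1 := C1Close.layer hσ hC hε hw ham hbm hm hms h (p3 i 0) (q3 i 0) (e3 i 0) (p4 i 0)
      (q4 i 0) (e4 i 0)
    rw [← hr] at s1
    set m := 2 * M * √n * C * (2 * r ^ 2) ^ (i : ℕ) with hm'
    set s := (2 * M * √n * C) ^ 2 * (5 * r ^ 4) ^ (i : ℕ) with hs'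
    set b := √n * C * (2 * w ^ 2 * C ^ 4) ^ (i : ℕ) with hb'
    have hrm : 1 ≤ r * m := one_le_mul_of_one_le_of_one_le (by linarith) hm
    have hb0 : 0 ≤ b := (h q).nonneg.2
    have s2 := C1Close.layer hσ hC hε hw (a := C) (b := w * C ^ 2 * b) (m := r * m)
      (s := 2 * r ^ 2 * s) (by rw [hr]; nlinarith)
      (mul_le_mul (by rw [hr]; linarith) hbm hb0 (by linarith))
      hrm (by rw [mul_pow]; nlinarith [sq_nonneg r]) s1
      (p3 i 1) (q3 i 1) (e3 i 1) (p4 i 1) (q4 i 1) (e4 i 1) q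
    rw [← hr] at s2
    -- Two layers multiply the Lipschitz scales by `r ^ 2` and `4 * r ^ 4`; the skip connection adds
    -- the old scales once more, whence `2 * r ^ 2` and `5 * r ^ 4`.
    refine (s2.add (h q)).mono hε ?_ ?_ ?_ ?_
    · push_cast; linarith
    · rw [show √n * C * (2 * w ^ 2 * C ^ 4) ^ ((i : ℕ) + 1) = b * (2 * (w ^ 2 * C ^ 4)) by
        rw [hb']; ring]
      have : b ≤ b * (w ^ 2 * C ^ 4) := le_mul_of_one_le_right hb0
        (by rw [show (w : ℝ) ^ 2 * C ^ 4 = (w * C ^ 2) ^ 2 by ring]; exact one_le_pow₀ hWC2)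
      linarith
    · rw [show 2 * M * √n * C * (2 * r ^ 2) ^ ((i : ℕ) + 1) = m * (2 * r ^ 2) by rw [hm']; ring]
     ; nlinarith
    · rw [show (2 * M * √n * C) ^ 2 * (5 * r ^ 4) ^ ((i : ℕ) + 1) = s * (5 * r ^ 4) by rw [hs']; ring]
      have : 1 ≤ r ^ 4 := one_le_pow₀ (by linarith)
      nlinarith [sq_nonneg m]) q

/-- `C¹` bounds for a pair of residual networks on a ball of radius `M`. -/
lemma DRRParam.c1Close_net {n d w : ℕ} (hn : 1 ≤ n) (hd : 1 ≤ d) (hw : 1 ≤ w) {σ : ℝ → ℝ}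
    {C M ε : ℝ} (hσ : ActivationBound σ C) (hC : 1 ≤ C) (hM : 1 ≤ M) (hε : 0 ≤ ε)
    {θ θ' : DRRParam n d w} (hθ : ∀ k, |θ.coord k| ≤ C) (hθ' : ∀ k, |θ'.coord k| ≤ C)
    (hθθ : ∀ k, |θ.coord k - θ'.coord k| ≤ ε) {x : E n} (hx : ‖x‖ ≤ M) :
    C1Close x ε (2 * M * √n * 2 ^ d * w ^ (2 * d + 1) * C ^ (4 * d + 2))
      (2 * M * √n * 2 ^ d * w ^ (2 * d + 1) * C ^ (4 * d + 2))
      (3 * w * C ^ 2 * ((2 * M * √n * C) ^ 2 * (5 * (3 * w * C ^ 2) ^ 4) ^ d))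
      (3 * w * C ^ 2 * ((2 * M * √n * C) ^ 2 * (5 * (3 * w * C ^ 2) ^ 4) ^ d))
      (θ.net σ) (θ'.net σ) := by
  have hfold := DRRParam.c1Close_blocks (r := 3 * w * C ^ 2) hn hw hσ hC hM hε hθ hθ' hθθ hx rfl
  simp only [DRRParam.coord, Sum.forall, Prod.forall, Sum.elim_inl, Sum.elim_inr] at hθ hθ' hθθ
  obtain ⟨p1, p2, p3, p4, p5, p6⟩ := hθ
  obtain ⟨q1, q2, q3, q4, q5, q6⟩ := hθ'
  obtain ⟨e1, e2, e3, e4, e5, e6⟩ := hθθ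
  have hW : (1 : ℝ) ≤ w := by exact_mod_cast hw
  have hn' : (1 : ℝ) ≤ √n := Real.one_le_sqrt.2 (by exact_mod_cast hn)
  have hMn : 1 ≤ M * √n := one_le_mul_of_one_le_of_one_le hM hn'
  have hnM : √n ≤ M * √n := le_mul_of_one_le_left (by linarith) hM
  have hWC2 : 1 ≤ w * C ^ 2 := one_le_mul_of_one_le_of_one_le hW (one_le_pow₀ hC)
  set D := 2 * M * √n * C with hD
  set r := 3 * w * C ^ 2 with hr
  have hout := C1Close.affine hfold p5 q5 e5 (p6 ()) (q6 ()) (e6 ())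
  -- Turns the linear growth of the values into the factor `2 ^ d` shared with the derivative bound.
  -- Equality holds at `d = 1`, so at least one block is needed.
  have hd' : ((d : ℕ) : ℝ) + 3 ≤ 2 * 2 ^ d := by
    have : ∀ k : ℕ, 1 ≤ k → k + 3 ≤ 2 * 2 ^ k := fun k hk => by
      induction k, hk using Nat.le_induction with
      | base => norm_num
      | succ k hk ih => rw [pow_succ]; omega
    exact_mod_cast this d hd
  have hWC : (w : ℝ) ≤ w * C := le_mul_of_one_le_right (by linarith) hC
  have hCC : C ≤ C ^ 2 := le_self_pow₀ hC two_ne_zero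
  obtain ⟨hD1, hm1, hms2, had, hbd⟩ := residual_scale_le hn' hM hC hW hr d
  rw [← hD] at hm1 hms2 had hbd
  set m := D * (2 * r ^ 2) ^ d with hm'
  set s := D ^ 2 * (5 * r ^ 4) ^ d with hs'
  have hms : m ≤ s := by nlinarith
  have hWCs : w * C * s ≤ w * C ^ 2 * s := by gcongr
  have hmsW : w * C * m ≤ w * C ^ 2 * s := by gcongr
  have hWm : w * m ≤ w * C * m := by gcongr
  have hm2 : m ≤ w * C ^ 2 * s := hms.trans (le_mul_of_one_le_left (by linarith) hWC2)
  refine hout.mono hε ?_ ?_ ?_ ?_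
  · have h1 : w * C * (C * (2 * M * √n + d)) + C ≤ M * √n * (d + 3) * (w * C ^ 2) := by
      have f1 : (d : ℝ) ≤ M * √n * d := le_mul_of_one_le_left (by positivity) hMn
      have f2 : C ≤ M * √n * (w * C ^ 2) := by
        calc C ≤ C ^ 2 := hCC
          _ ≤ w * C ^ 2 := le_mul_of_one_le_left (by positivity) hW
          _ ≤ _ := le_mul_of_one_le_left (by linarith) hMn
      have f3 : w * C ^ 2 * d ≤ w * C ^ 2 * (M * √n * d) := by gcongr
      linarith
    refine h1.trans ?_
    calc M * √n * (d + 3) * (w * C ^ 2) ≤ M * √n * (2 * 2 ^ d) * (w ^ (2 * d + 1) * C ^ (4 * d + 2)) := by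
          gcongr
          · exact le_self_pow₀ hW (by omega)
          · omega
      _ = _ := by ring
  · calc w * C * (√n * C * (2 * w ^ 2 * C ^ 4) ^ d)
        = √n * 2 ^ d * w ^ (2 * d + 1) * C ^ (4 * d + 2) := by
          rw [mul_pow, mul_pow, ← pow_mul, ← pow_mul]; ring
      _ ≤ _ := by gcongr; linarith
  · have : w * (C * (2 * M * √n + d)) ≤ w * m := by gcongr
    rw [hr]
    linarith
  · have : w * (√n * C * (2 * w ^ 2 * C ^ 4) ^ d) ≤ w * m := by gcongr
    rw [hr]
    linarith

/-- `C¹` bounds for a pair of feedforward networks on a ball of radius `R`. -/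
lemma FFNParam.c1Close_net {n d w : ℕ} (hn : 1 ≤ n) (hw : 1 ≤ w) {σ : ℝ → ℝ}
    {C R ε : ℝ} (hσ : ActivationBound σ C) (hC : 1 ≤ C) (hR : 1 ≤ R) (hε : 0 ≤ ε)
    {θ θ' : FFNParam n d w} (hθ : ∀ k, |θ.coord k| ≤ C) (hθ' : ∀ k, |θ'.coord k| ≤ C)
    (hθθ : ∀ k, |θ.coord k - θ'.coord k| ≤ ε) {x : E n} (hx : ‖x‖ ≤ R) :
    C1Close x ε (2 * √n * w ^ (d + 1) * C ^ (2 * d + 3))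
      (2 * √n * w ^ (d + 1) * C ^ (2 * d + 3))
      (3 * w * C ^ 2 * ((2 * √n * R * C ^ 2) ^ 2 * (2 * (3 * w * C ^ 2) ^ 2) ^ d))
      (3 * w * C ^ 2 * ((2 * √n * R * C ^ 2) ^ 2 * (2 * (3 * w * C ^ 2) ^ 2) ^ d))
      (θ.net σ) (θ'.net σ) := by
  simp only [FFNParam.coord, Sum.forall, Prod.forall, Sum.elim_inl, Sum.elim_inr] at hθ hθ' hθθ
  obtain ⟨p1, p2, p3, p4, p5, p6⟩ := hθ
  obtain ⟨q1, q2, q3, q4, q5, q6⟩ := hθ'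
  obtain ⟨e1, e2, e3, e4, e5, e6⟩ := hθθ
  have hW : (1 : ℝ) ≤ w := by exact_mod_cast hw
  have hn' : (1 : ℝ) ≤ √n := Real.one_le_sqrt.2 (by exact_mod_cast hn)
  have hnR : 1 ≤ √n * R := one_le_mul_of_one_le_of_one_le hn' hR
  have hWC2 : 1 ≤ w * C ^ 2 := one_le_mul_of_one_le_of_one_le hW (one_le_pow₀ hC)
  have hCC : C ≤ C ^ 2 := le_self_pow₀ hC two_ne_zero
  have hnR' : √n ≤ √n * R := le_mul_of_one_le_right (by linarith) hR
  set D := 2 * √n * R * C ^ 2 with hD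
  have hCD : C ^ 2 ≤ D := by
    rw [hD]; exact le_mul_of_one_le_left (by positivity) (by linarith)
  have hnD : √n * C ^ 2 ≤ D := by
    rw [hD]; gcongr; linarith
  have hD1 : 1 ≤ D := by linarith
  set r := 3 * w * C ^ 2 with hr
  have hr3 : 3 ≤ r := by rw [hr]; linarith
  have hbm : ∀ i : ℕ, √n * C ^ 2 * (w * C ^ 2) ^ i ≤ D * r ^ i := by
    intro i
    have : w * C ^ 2 ≤ r := by rw [hr]; linarith
    gcongr
  have hm : ∀ i : ℕ, 1 ≤ D * r ^ i := fun i =>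
    one_le_mul_of_one_le_of_one_le hD1 (one_le_pow₀ (by linarith))
  have ham : ∀ i : ℕ, C ≤ D * r ^ i := fun i => by
    have : 1 ≤ r ^ i := one_le_pow₀ (by linarith)
    nlinarith
  have hms : ∀ i : ℕ, (D * r ^ i) ^ 2 ≤ D ^ 2 * (2 * r ^ 2) ^ i := by
    intro i
    rw [mul_pow, ← pow_mul, mul_comm i, pow_mul]
    gcongr
    nlinarith
  -- After the first `σ` the value bound is `C` and the derivative bound is free of `R`; the radius
  -- survives only in the Lipschitz scales, through `D`.
  have hbase : ∀ q, C1Close x ε C (√n * C ^ 2 * (w * C ^ 2) ^ 0)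
      (D * r ^ 0) (D ^ 2 * (2 * r ^ 2) ^ 0)
      (fun y : E n => (σ ∘ (θ.A₀ *ᵥ y.ofLp + θ.b₀)) q)
      (fun y => (σ ∘ (θ'.A₀ *ᵥ y.ofLp + θ'.b₀)) q) := by
    intro q
    have hl : C * (√n * R + 1) ≤ D := by
      calc C * (√n * R + 1) ≤ C ^ 2 * (2 * (√n * R)) := by gcongr; linarith
        _ = D := by rw [hD]; ring
    refine (C1Close.comp hσ (C1Close.affineFunctional hε (by linarith) hx (p1 q) (q1 q) (e1 q)
      (p2 q) (q2 q) (e2 q))).mono hε le_rfl (by linarith) ?_ ?_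
    · rw [pow_zero, mul_one]; exact hl
    · rw [pow_zero, mul_one]
      have h1 : √n * C ≤ √n * C ^ 2 := by gcongr
      have h2 : C * (√n * R + 1) * (√n * C) ≤ D * (√n * C ^ 2) := by gcongr
      have h3 : 2 * (√n * C ^ 2) ≤ D := by rw [hD]; nlinarith [sq_nonneg C]
      nlinarith
  have hfold := foldl_induction₂ (fun i z => σ ∘ (θ.A i *ᵥ z + θ.b i))
    (fun i z => σ ∘ (θ'.A i *ᵥ z + θ'.b i))
    (fun i F G => ∀ q, C1Close x ε C (√n * C ^ 2 * (w * C ^ 2) ^ i)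
      (D * r ^ i) (D ^ 2 * (2 * r ^ 2) ^ i)
      (fun y : E n => F y q) (fun y => G y q)) hbase (by
    intro i F G h q
    have s1 := C1Close.layer hσ hC hε hw (ham i) (hbm i) (hm i) (hms i) h (p3 i) (q3 i) (e3 i)
      (p4 i) (q4 i) (e4 i) q
    rw [← hr] at s1
    exact s1.mono hε le_rfl (by rw [pow_succ _ (i : ℕ)]; linarith)
      (by rw [pow_succ _ (i : ℕ)]; linarith) (by rw [pow_succ _ (i : ℕ)]; linarith))
  have hout := C1Close.affine hfold p5 q5 e5 (p6 ()) (q6 ()) (e6 ())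
  have hWC : (w : ℝ) ≤ w * C := le_mul_of_one_le_right (by linarith) hC
  have hbd := hbm d
  have had := ham d
  have hmd := hm d
  have hmsd := hms d
  set m := D * r ^ d with hm'
  set s := D ^ 2 * (2 * r ^ 2) ^ d with hs'
  have hms' : m ≤ s := by nlinarith
  have hWCs : w * C * s ≤ w * C ^ 2 * s := by gcongr
  have hmsW : w * C * m ≤ w * C ^ 2 * s := by gcongr
  have hWm : w * m ≤ w * C * m := by gcongr
  have hm2 : m ≤ w * C ^ 2 * s := hms'.trans (le_mul_of_one_le_left (by linarith) hWC2)
  refine hout.mono hε ?_ ?_ ?_ ?_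
  · calc w * C * C + C ≤ 2 * 1 * w ^ 1 * C ^ 2 := by
          have : C ^ 2 ≤ w * C ^ 2 := le_mul_of_one_le_left (by positivity) hW
          linarith
      _ ≤ _ := by gcongr <;> first | assumption | omega
  · calc w * C * (√n * C ^ 2 * (w * C ^ 2) ^ d)
        = √n * w ^ (d + 1) * C ^ (2 * d + 3) := by
          rw [mul_pow, ← pow_mul]; ring
      _ ≤ _ := by gcongr; linarith
  · have : w * C ≤ w * m := by gcongr
    rw [hr]
    linarith
  · have : w * (√n * C ^ 2 * (w * C ^ 2) ^ d) ≤ w * m := by gcongr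
    rw [hr]
    linarith

lemma FFNParam.card_coord (n d w : ℕ) :
    Fintype.card ((Fin w × Fin n) ⊕ Fin w ⊕ (Fin d × Fin w × Fin w) ⊕ (Fin d × Fin w) ⊕
      Fin w ⊕ Unit) = ffnParamCount n d w := by
  simp [ffnParamCount]; ring

lemma DRRParam.card_coord (n d w : ℕ) :
    Fintype.card ((Fin w × Fin n) ⊕ Fin w ⊕ (Fin d × Fin 2 × Fin w × Fin w) ⊕
      (Fin d × Fin 2 × Fin w) ⊕ Fin w ⊕ Unit) = drrParamCount n d w := by
  simp [drrParamCount]; ring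

end ObstacleNN

namespace ObstacleNN

/-! ### The integrand of the objective -/

lemma norm_gradient {n : ℕ} (u : E n → ℝ) (x : E n) : ‖∇ u x‖ = ‖fderiv ℝ u x‖ := by
  simp [gradient]

lemma norm_gradient_sub {n : ℕ} (u v : E n → ℝ) (x : E n) :
    ‖∇ u x - ∇ v x‖ = ‖fderiv ℝ u x - fderiv ℝ v x‖ := by
  rw [gradient, gradient, ← map_sub, LinearIsometryEquiv.norm_map]

lemma continuousOn_gradient {n : ℕ} {Ω : Set (E n)} (hΩ : IsOpen Ω) {u : E n → ℝ}
    (hu : ContDiffOn ℝ 1 u Ω) : ContinuousOn (∇ u) Ω :=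
  (LinearIsometryEquiv.continuous _).comp_continuousOn
    (hu.continuousOn_fderiv_of_isOpen hΩ le_rfl)

lemma abs_inner_sub_inner_le {V : Type*} [NormedAddCommGroup V] [InnerProductSpace ℝ V]
    {p q p' q' : V} {a b s t : ℝ} (hp' : ‖p'‖ ≤ a) (hq : ‖q‖ ≤ b) (hs : ‖p - p'‖ ≤ s)
    (ht : ‖q - q'‖ ≤ t) : |inner ℝ p q - inner ℝ p' q'| ≤ s * b + a * t := by
  have h : inner ℝ p q - inner ℝ p' q' = inner ℝ (p - p') q + inner ℝ p' (q - q') := by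
    rw [inner_sub_left, inner_sub_right]; ring
  rw [h]
  refine (abs_add_le _ _).trans (add_le_add ?_ ?_)
  · exact (abs_real_inner_le_norm _ _).trans
      (mul_le_mul hs hq (norm_nonneg _) ((norm_nonneg _).trans hs))
  · exact (abs_real_inner_le_norm _ _).trans
      (mul_le_mul hp' ht (norm_nonneg _) ((norm_nonneg _).trans hp'))

lemma abs_mul_sub_mul_le {p q p' q' a b s t : ℝ} (hp' : |p'| ≤ a) (hq : |q| ≤ b)
    (hs : |p - p'| ≤ s) (ht : |q - q'| ≤ t) : |p * q - p' * q'| ≤ s * b + a * t := by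
  have := abs_inner_sub_inner_le (V := ℝ) hp' hq hs ht
  simpa [mul_comm] using this

namespace ObstacleProblem

variable {n : ℕ}

/-- The pointwise integrand of the objective. -/
noncomputable def integrand (P : ObstacleProblem n) (u v : E n → ℝ) (x : E n) : ℝ :=
  inner ℝ (∇ u x) (∇ u x - ∇ v x) + P.k * u x * (u x - v x) - P.f x * (u x - v x) -
    1 / (2 * P.γ) * ((u x - v x) ^ 2 + ‖∇ u x - ∇ v x‖ ^ 2) +
    P.w₁ * (max (P.ψ x - u x) 0) ^ 2 - P.w₂ * (max (P.ψ x - v x) 0) ^ 2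

lemma objectiveMC_eq (P : ObstacleProblem n) {N : ℕ} (x : Fin N → E n) (u v : E n → ℝ) :
    P.objectiveMC x u v =
      (volume P.Ω).toReal * ((1 / N : ℝ) * ∑ i, P.integrand u v (x i)) := by
  simp only [objectiveMC, lossRegMC, lossMC, obstacleLossMC, integrand, Finset.sum_add_distrib,
    Finset.sum_sub_distrib, ← Finset.mul_sum]
  ring

lemma abs_max_zero_le {t a : ℝ} (ht : |t| ≤ a) : |max t 0| ≤ a := by
  rw [abs_of_nonneg (le_max_right _ _)]
  exact max_le ((le_abs_self t).trans ht) ((abs_nonneg t).trans ht)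

/-- Bounds of the integrand in terms of bounds of `u`, `v` and their gradients. -/
lemma abs_integrand_le {P : ObstacleProblem n} {M H : ℝ} (hP : P.Admissible)
    (hPM : P.BoundedBy M) (hM : 1 ≤ M) (hH : 1 ≤ H) {u v : E n → ℝ}
    (hu : C1BoundedOn P.Ω H u) (hv : C1BoundedOn P.Ω H v) {x : E n} (hx : x ∈ P.Ω) :
    |P.integrand u v x| ≤ 18 * M ^ 3 * H ^ 2 := by
  obtain ⟨u0, u1⟩ := hu x hx
  obtain ⟨v0, v1⟩ := hv x hx
  have hd0 : |u x - v x| ≤ 2 * H := (abs_sub _ _).trans (by linarith)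
  have hd1 : ‖∇ u x - ∇ v x‖ ≤ 2 * H := (norm_sub_le _ _).trans (by linarith)
  have hMM : M ≤ M ^ 3 := le_self_pow₀ hM three_ne_zero
  have hM3 : 1 ≤ M ^ 3 := one_le_pow₀ hM
  have hHH : H ≤ H ^ 2 := le_self_pow₀ hH two_ne_zero
  have hMH : M * H ^ 2 ≤ M ^ 3 * H ^ 2 := by gcongr
  have hH2 : H ^ 2 ≤ M ^ 3 * H ^ 2 := le_mul_of_one_le_left (by positivity) hM3
  have hk : |P.k| ≤ M := by rw [abs_of_nonneg hP.k_nonneg]; exact hPM.k_le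
  have hw₁ : |P.w₁| ≤ M := by rw [abs_of_nonneg hP.w₁_nonneg]; exact hPM.w₁_le
  have hw₂ : |P.w₂| ≤ M := by rw [abs_of_nonneg hP.w₂_nonneg]; exact hPM.w₂_le
  have hγ : |1 / (2 * P.γ)| ≤ M / 2 := by
    rw [abs_of_nonneg (by have := hP.γ_pos; positivity), one_div, mul_inv, ← one_div P.γ]
    linarith [hPM.γ_inv_le]
  have t1 : |inner ℝ (∇ u x) (∇ u x - ∇ v x)| ≤ 2 * (M ^ 3 * H ^ 2) := by
    refine (abs_real_inner_le_norm _ _).trans ?_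
    have := mul_le_mul u1 hd1 (norm_nonneg _) (by linarith)
    linarith
  have t2 : |P.k * u x * (u x - v x)| ≤ 2 * (M ^ 3 * H ^ 2) := by
    rw [abs_mul, abs_mul]
    have : |P.k| * |u x| * |u x - v x| ≤ M * H * (2 * H) := by gcongr
    linarith
  have t3 : |P.f x * (u x - v x)| ≤ 2 * (M ^ 3 * H ^ 2) := by
    rw [abs_mul]
    have h1 : |P.f x| * |u x - v x| ≤ M * (2 * H) := by gcongr; exact hPM.f_le x hx
    have h2 : M * H ≤ M * H ^ 2 := by gcongr
    linarith
  have t4 : |1 / (2 * P.γ) * ((u x - v x) ^ 2 + ‖∇ u x - ∇ v x‖ ^ 2)| ≤ 4 * (M ^ 3 * H ^ 2) := by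
    rw [abs_mul, abs_of_nonneg (show 0 ≤ (u x - v x) ^ 2 + ‖∇ u x - ∇ v x‖ ^ 2 by positivity),
      ← sq_abs (u x - v x)]
    have : |1 / (2 * P.γ)| * (|u x - v x| ^ 2 + ‖∇ u x - ∇ v x‖ ^ 2) ≤
        M / 2 * ((2 * H) ^ 2 + (2 * H) ^ 2) := by gcongr
    linarith
  have hψ : ∀ t, |t| ≤ H → |max (P.ψ x - t) 0| ≤ 2 * (M * H) := fun t ht =>
    abs_max_zero_le <| (abs_sub _ _).trans <| by
      have h1 := hPM.ψ_le x hx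
      have h2 : M ≤ M * H := le_mul_of_one_le_right (by linarith) hH
      have h3 : H ≤ M * H := le_mul_of_one_le_left (by linarith) hM
      linarith
  have t5 : ∀ w t, |w| ≤ M → |t| ≤ H → |w * (max (P.ψ x - t) 0) ^ 2| ≤ 4 * (M ^ 3 * H ^ 2) := by
    intro w t hw ht
    rw [abs_mul, abs_pow]
    have : |w| * |max (P.ψ x - t) 0| ^ 2 ≤ M * (2 * (M * H)) ^ 2 := by
      gcongr; exact hψ t ht
    linarith
  have s1 := t5 _ _ hw₁ u0
  have s2 := t5 _ _ hw₂ v0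
  -- The six terms contribute `2 + 2 + 2 + 4 + 4 + 4 = 18`.
  rw [abs_le] at t1 t2 t3 t4 s1 s2 ⊢
  rw [integrand]
  constructor <;> linarith

/-- Lipschitz dependence of the integrand on `u`, `v` in `C¹`. -/
lemma abs_integrand_sub_le {P : ObstacleProblem n} {M H l : ℝ} (hP : P.Admissible)
    (hPM : P.BoundedBy M) (hM : 1 ≤ M) (hH : 1 ≤ H) {u v u' v' : E n → ℝ}
    {x : E n} (hx : x ∈ P.Ω) (hu : C1Close x l H H 1 1 u u') (hv : C1Close x l H H 1 1 v v') :
    |P.integrand u v x - P.integrand u' v' x| ≤ 26 * M ^ 2 * H * l := by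
  have u0 := hu.abs_left
  have v0 := hv.abs_left
  have u0' := hu.abs_right
  have v0' := hv.abs_right
  have du := hu.abs_sub
  have dv := hv.abs_sub
  have u1 := hu.fderiv_left
  have v1 := hv.fderiv_left
  have u1' := hu.fderiv_right
  have v1' := hv.fderiv_right
  have gu := hu.fderiv_sub
  have gv := hv.fderiv_sub
  rw [← norm_gradient] at u1 v1 u1' v1'
  rw [← norm_gradient_sub] at gu gv
  rw [one_mul] at du dv gu gv
  have hl : 0 ≤ l := (abs_nonneg _).trans du
  have hd0 : |u x - v x| ≤ 2 * H := (abs_sub _ _).trans (by linarith)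
  have hd1 : ‖∇ u x - ∇ v x‖ ≤ 2 * H := (norm_sub_le _ _).trans (by linarith)
  have hd0' : |u' x - v' x| ≤ 2 * H := (abs_sub _ _).trans (by linarith)
  have hd1' : ‖∇ u' x - ∇ v' x‖ ≤ 2 * H := (norm_sub_le _ _).trans (by linarith)
  have hdd0 : |(u x - v x) - (u' x - v' x)| ≤ 2 * l := by
    rw [sub_sub_sub_comm]; exact (abs_sub _ _).trans (by linarith)
  have hdd1 : ‖(∇ u x - ∇ v x) - (∇ u' x - ∇ v' x)‖ ≤ 2 * l := by
    rw [sub_sub_sub_comm]; exact (norm_sub_le _ _).trans (by linarith)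
  have hM2 : M ≤ M ^ 2 := le_self_pow₀ hM two_ne_zero
  have hHl : H * l ≤ M ^ 2 * (H * l) :=
    le_mul_of_one_le_left (by positivity) (one_le_pow₀ hM)
  have hMHl : M * (H * l) ≤ M ^ 2 * (H * l) := by gcongr
  have hk : |P.k| ≤ M := by rw [abs_of_nonneg hP.k_nonneg]; exact hPM.k_le
  have hw₁ : |P.w₁| ≤ M := by rw [abs_of_nonneg hP.w₁_nonneg]; exact hPM.w₁_le
  have hw₂ : |P.w₂| ≤ M := by rw [abs_of_nonneg hP.w₂_nonneg]; exact hPM.w₂_le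
  have hγ : |1 / (2 * P.γ)| ≤ M / 2 := by
    rw [abs_of_nonneg (by have := hP.γ_pos; positivity), one_div, mul_inv, ← one_div P.γ]
    linarith [hPM.γ_inv_le]
  have t1 : |inner ℝ (∇ u x) (∇ u x - ∇ v x) - inner ℝ (∇ u' x) (∇ u' x - ∇ v' x)| ≤
      4 * (M ^ 2 * (H * l)) := by
    refine (abs_inner_sub_inner_le u1' hd1 gu hdd1).trans ?_
    linarith
  have t2 : |P.k * u x * (u x - v x) - P.k * u' x * (u' x - v' x)| ≤ 4 * (M ^ 2 * (H * l)) := by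
    rw [mul_assoc, mul_assoc, ← mul_sub, abs_mul]
    have : |P.k| * |u x * (u x - v x) - u' x * (u' x - v' x)| ≤ M * (l * (2 * H) + H * (2 * l)) := by
      gcongr
      exact abs_mul_sub_mul_le u0' hd0 du hdd0
    linarith
  have t3 : |P.f x * (u x - v x) - P.f x * (u' x - v' x)| ≤ 2 * (M ^ 2 * (H * l)) := by
    rw [← mul_sub, abs_mul]
    have h1 : |P.f x| * |u x - v x - (u' x - v' x)| ≤ M * (2 * l) := by
      gcongr; exact hPM.f_le x hx
    have h2 : M * l ≤ M * (H * l) := by gcongr; exact le_mul_of_one_le_left hl hH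
    linarith
  have t4 : |1 / (2 * P.γ) * ((u x - v x) ^ 2 + ‖∇ u x - ∇ v x‖ ^ 2) -
      1 / (2 * P.γ) * ((u' x - v' x) ^ 2 + ‖∇ u' x - ∇ v' x‖ ^ 2)| ≤ 8 * (M ^ 2 * (H * l)) := by
    rw [← mul_sub, abs_mul]
    have h1 := abs_mul_sub_mul_le hd0' hd0 hdd0 hdd0
    have h2 := abs_inner_sub_inner_le hd1' hd1 hdd1 hdd1
    rw [real_inner_self_eq_norm_sq, real_inner_self_eq_norm_sq] at h2
    have h3 : |(u x - v x) ^ 2 + ‖∇ u x - ∇ v x‖ ^ 2 -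
        ((u' x - v' x) ^ 2 + ‖∇ u' x - ∇ v' x‖ ^ 2)| ≤ 16 * (H * l) := by
      rw [add_sub_add_comm, sq (u x - v x), sq (u' x - v' x)]
      refine (abs_add_le _ _).trans ?_
      linarith
    have : |1 / (2 * P.γ)| * |(u x - v x) ^ 2 + ‖∇ u x - ∇ v x‖ ^ 2 -
        ((u' x - v' x) ^ 2 + ‖∇ u' x - ∇ v' x‖ ^ 2)| ≤ M / 2 * (16 * (H * l)) := by gcongr
    linarith
  have hψ : ∀ t, |t| ≤ H → |max (P.ψ x - t) 0| ≤ 2 * (M * H) := fun t ht =>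
    abs_max_zero_le <| (abs_sub _ _).trans <| by
      have h1 := hPM.ψ_le x hx
      have h2 : M ≤ M * H := le_mul_of_one_le_right (by linarith) hH
      have h3 : H ≤ M * H := le_mul_of_one_le_left (by linarith) hM
      linarith
  have t5 : ∀ w t t', |w| ≤ M → |t| ≤ H → |t'| ≤ H → |t - t'| ≤ l →
      |w * (max (P.ψ x - t) 0) ^ 2 - w * (max (P.ψ x - t') 0) ^ 2| ≤ 4 * (M ^ 2 * (H * l)) := by
    intro w t t' hw ht ht' htt
    have hmax : |max (P.ψ x - t) 0 - max (P.ψ x - t') 0| ≤ l := by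
      refine (abs_max_sub_max_le_abs _ _ _).trans ?_
      rw [sub_sub_sub_cancel_left, abs_sub_comm]
      exact htt
    have h1 := abs_mul_sub_mul_le (hψ t' ht') (hψ t ht) hmax hmax
    rw [← sq, ← sq] at h1
    rw [← mul_sub, abs_mul]
    have : |w| * |max (P.ψ x - t) 0 ^ 2 - max (P.ψ x - t') 0 ^ 2| ≤
        M * (l * (2 * (M * H)) + 2 * (M * H) * l) := by gcongr
    linarith
  have s1 := t5 _ _ _ hw₁ u0 u0' du
  have s2 := t5 _ _ _ hw₂ v0 v0' dv
  -- The six terms contribute `4 + 4 + 2 + 8 + 4 + 4 = 26`.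
  rw [abs_le] at t1 t2 t3 t4 s1 s2 ⊢
  simp only [integrand]
  constructor <;> linarith

/-! ### Continuity, integrability and measurability -/

section Regular

variable {P : ObstacleProblem n} {M H : ℝ} {u v : E n → ℝ}

lemma Admissible.continuousOn_integrand (hP : P.Admissible) (hu : ContDiffOn ℝ 1 u P.Ω)
    (hv : ContDiffOn ℝ 1 v P.Ω) : ContinuousOn (P.integrand u v) P.Ω := by
  have hu0 := hu.continuousOn
  have hv0 := hv.continuousOn
  have hu1 := continuousOn_gradient hP.isOpen hu
  have hv1 := continuousOn_gradient hP.isOpen hv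
  have hf := hP.continuous_f
  have hψ := hP.continuous_ψ
  have hi : ContinuousOn (fun x => inner ℝ (∇ u x) (∇ u x - ∇ v x)) P.Ω := hu1.inner (hu1.sub hv1)
  have hm : ∀ t : E n → ℝ, ContinuousOn t P.Ω →
      ContinuousOn (fun x => max (P.ψ x - t x) 0 ^ 2) P.Ω := fun t ht =>
    ((hψ.sub ht).sup continuousOn_const).pow 2
  have hm1 := hm u hu0
  have hm2 := hm v hv0
  have hn : ContinuousOn (fun x => ‖∇ u x - ∇ v x‖) P.Ω := (hu1.sub hv1).norm
  unfold integrand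
  fun_prop

lemma Admissible.isProbabilityMeasure (hP : P.Admissible) :
    IsProbabilityMeasure (ProbabilityTheory.cond volume P.Ω) :=
  ProbabilityTheory.cond_isProbabilityMeasure_of_finite
    (hP.isOpen.measure_pos volume hP.nonempty).ne' hP.isBounded.measure_lt_top.ne

lemma Admissible.ae_mem (hP : P.Admissible) : ∀ᵐ x ∂(ProbabilityTheory.cond volume P.Ω), x ∈ P.Ω :=
  ProbabilityTheory.ae_cond_mem hP.isOpen.measurableSet

lemma Admissible.aemeasurable (hP : P.Admissible) {g : E n → ℝ} (hg : ContinuousOn g P.Ω) :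
    AEMeasurable g (ProbabilityTheory.cond volume P.Ω) :=
  (hg.aemeasurable hP.isOpen.measurableSet).mono_ac
    (Measure.AbsolutelyContinuous.rfl.smul_left _)

lemma Admissible.integrableOn (hP : P.Admissible) {g : E n → ℝ} (hg : ContinuousOn g P.Ω) {C : ℝ}
    (hC : ∀ x ∈ P.Ω, |g x| ≤ C) : IntegrableOn g P.Ω volume :=
  IntegrableOn.of_bound hP.isBounded.measure_lt_top
    (hg.aestronglyMeasurable hP.isOpen.measurableSet) C
    ((ae_restrict_iff' hP.isOpen.measurableSet).2 (ae_of_all _ hC))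

/-- The `C¹` bounds make each integrand separately integrable on the bounded set `Ω`, which
justifies merging the integrals. Normalising the volume costs the factor `|Ω|`. -/
lemma Admissible.objective_eq (hP : P.Admissible) (hPM : P.BoundedBy M)
    (hu : ContDiffOn ℝ 1 u P.Ω) (hv : ContDiffOn ℝ 1 v P.Ω)
    (huH : C1BoundedOn P.Ω H u) (hvH : C1BoundedOn P.Ω H v) :
    P.objective u v = (volume P.Ω).toReal *
      ∫ x, P.integrand u v x ∂(ProbabilityTheory.cond volume P.Ω) := by
  have hu0 := hu.continuousOn
  have hv0 := hv.continuousOn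
  have hu1 := continuousOn_gradient hP.isOpen hu
  have hv1 := continuousOn_gradient hP.isOpen hv
  have hf := hP.continuous_f
  have hψ := hP.continuous_ψ
  have hΩ := hP.isOpen.measurableSet
  have hd0 : ∀ x ∈ P.Ω, |u x - v x| ≤ H + H := fun x hx =>
    (abs_sub _ _).trans (add_le_add (huH x hx).1 (hvH x hx).1)
  have hd1 : ∀ x ∈ P.Ω, ‖∇ u x - ∇ v x‖ ≤ H + H := fun x hx =>
    (norm_sub_le _ _).trans (add_le_add (huH x hx).2 (hvH x hx).2)
  have i1 : IntegrableOn (fun x => inner ℝ (∇ u x) (∇ u x - ∇ v x) + P.k * u x * (u x - v x))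
      P.Ω volume := by
    refine hP.integrableOn ((hu1.inner (hu1.sub hv1)).add (by fun_prop))
      (C := H * (H + H) + |P.k| * H * (H + H)) fun x hx => (abs_add_le _ _).trans (add_le_add ?_ ?_)
    · have hH : 0 ≤ H := (abs_nonneg _).trans (huH x hx).1
      exact (abs_real_inner_le_norm _ _).trans
        (mul_le_mul (huH x hx).2 (hd1 x hx) (norm_nonneg _) hH)
    · have hH : 0 ≤ H := (abs_nonneg _).trans (huH x hx).1
      rw [abs_mul, abs_mul]
      gcongr
      · exact (huH x hx).1
      · exact hd0 x hx
  have i2 : IntegrableOn (fun x => P.f x * (u x - v x)) P.Ω volume := by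
    refine hP.integrableOn (by fun_prop) (C := M * (H + H)) fun x hx => ?_
    rw [abs_mul]
    exact mul_le_mul (hPM.f_le x hx) (hd0 x hx) (abs_nonneg _)
      ((abs_nonneg _).trans (hPM.f_le x hx))
  have i3 : IntegrableOn (fun x => (u x - v x) ^ 2 + ‖∇ u x - ∇ v x‖ ^ 2) P.Ω volume := by
    refine hP.integrableOn (((hu0.sub hv0).pow 2).add ((hu1.sub hv1).norm.pow 2))
      (C := (H + H) ^ 2 + (H + H) ^ 2) fun x hx => ?_
    rw [abs_of_nonneg (by positivity), ← sq_abs (u x - v x)]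
    gcongr
    · exact hd0 x hx
    · exact hd1 x hx
  have i4 : ∀ t : E n → ℝ, ContinuousOn t P.Ω → C1BoundedOn P.Ω H t →
      IntegrableOn (fun x => max (P.ψ x - t x) 0 ^ 2) P.Ω volume := by
    intro t ht htH
    refine hP.integrableOn (((hψ.sub ht).sup continuousOn_const).pow 2) (C := (M + H) ^ 2)
      fun x hx => ?_
    rw [abs_pow]
    gcongr
    exact abs_max_zero_le ((abs_sub _ _).trans (add_le_add (hPM.ψ_le x hx) (htH x hx).1))
  have hv0' : (volume P.Ω).toReal ≠ 0 := ENNReal.toReal_ne_zero.2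
    ⟨(hP.isOpen.measure_pos volume hP.nonempty).ne', hP.isBounded.measure_lt_top.ne⟩
  rw [ProbabilityTheory.cond, integral_smul_measure, ENNReal.toReal_inv, smul_eq_mul,
    mul_inv_cancel_left₀ hv0']
  simp only [integrand]
  rw [integral_sub, integral_add, integral_sub, integral_sub]
  · simp only [integral_const_mul]
    simp only [objective, lossReg, loss, obstacleLoss]
  · exact i1
  · exact i2
  · exact i1.sub i2
  · exact i3.const_mul _
  · exact (i1.sub i2).sub (i3.const_mul _)
  · exact (i4 u hu0 huH).const_mul _
  · exact ((i1.sub i2).sub (i3.const_mul _)).add ((i4 u hu0 huH).const_mul _)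
  · exact (i4 v hv0 hvH).const_mul _

lemma Admissible.ae_sampleLaw (hP : P.Admissible) (N : ℕ) :
    ∀ᵐ x ∂(P.sampleLaw N), ∀ k, x k ∈ P.Ω :=
  have := hP.isProbabilityMeasure
  ae_all_iff.2 fun k => (Measure.quasiMeasurePreserving_eval
    (fun _ : Fin N => ProbabilityTheory.cond volume P.Ω) k).ae hP.ae_mem

/-- The statistical error is, on `Ω^N`, a supremum of continuous functions. -/
lemma Admissible.aemeasurable_statError (hP : P.Admissible) {F G : Set (E n → ℝ)}
    (hF : ∀ u ∈ F, ContDiffOn ℝ 1 u P.Ω) (hG : ∀ v ∈ G, ContDiffOn ℝ 1 v P.Ω) (N : ℕ) :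
    AEMeasurable (fun x => P.statError F G x) (P.sampleLaw N) := by
  let S : Set (Fin N → E n) := Set.univ.pi fun _ => P.Ω
  have hS : IsOpen S := isOpen_set_pi Set.finite_univ fun _ _ => hP.isOpen
  have hcont : ∀ u ∈ F, ∀ v ∈ G, ContinuousOn
      (fun x : Fin N → E n => ENNReal.ofReal |P.objective u v - P.objectiveMC x u v|) S := by
    intro u hu v hv
    have hg : ContinuousOn (fun x : Fin N → E n => ∑ i, P.integrand u v (x i)) S :=
      continuousOn_finsetSum _ fun i _ => (hP.continuousOn_integrand (hF u hu) (hG v hv)).comp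
        (continuous_apply i).continuousOn fun x hx => hx i trivial
    simp only [objectiveMC_eq]
    exact ENNReal.continuous_ofReal.comp_continuousOn (by fun_prop)
  -- The suprema may be uncountable, but a superlevel set of a supremum of continuous functions on
  -- the open set `Ω^N` is a union of open sets. The indicator discards the null set outside `Ω^N`,
  -- where no regularity is available.
  refine ⟨S.indicator fun x => P.statError F G x, ?_, ?_⟩
  · refine measurable_of_Ioi fun a => ?_
    have : (S.indicator fun x => P.statError F G x) ⁻¹' Set.Ioi a =
        ⋃ u ∈ F, ⋃ v ∈ G, S ∩ (fun x : Fin N → E n =>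
          ENNReal.ofReal |P.objective u v - P.objectiveMC x u v|) ⁻¹' Set.Ioi a := by
      ext x
      by_cases hx : x ∈ S
      · simp [hx, statError, lt_iSup_iff]
      · simp [hx]
    rw [this]
    exact (isOpen_biUnion fun u hu => isOpen_biUnion fun v hv =>
      (hcont u hu v hv).isOpen_inter_preimage hS isOpen_Ioi).measurableSet
  · filter_upwards [hP.ae_sampleLaw N] with x hx
    rw [Set.indicator_of_mem (show x ∈ S from fun i _ => hx i)]

end Regular

end ObstacleProblem

end ObstacleNN

/-! ### Statistical error of a general parametric class -/

namespace ObstacleNN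

open ObstacleProblem

/-- The lift `h` cancels in differences, and the product rule for `F * η` gives the `2` and, with
`h` added, the `3`. The distance is moved into the `ε` slot with Lipschitz constants `1`, the form
required by `abs_integrand_sub_le`. -/
lemma C1Close.ansatz {n : ℕ} {x : E n} {ε M H l : ℝ} {F G η h : E n → ℝ}
    (hFG : C1Close x ε H H l l F G) (hη : DifferentiableAt ℝ η x) (hh : DifferentiableAt ℝ h x)
    (hη0 : |η x| ≤ M) (hη1 : ‖∇ η x‖ ≤ M) (hh0 : |h x| ≤ M * H) (hh1 : ‖∇ h x‖ ≤ M * H) :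
    C1Close x (2 * M * l * ε) (3 * (M * H)) (3 * (M * H)) 1 1
      (fun y => F y * η y + h y) (fun y => G y * η y + h y) := by
  rw [norm_gradient] at hη1 hh1
  have key := (hFG.mul (C1Close.refl (ε := ε) hη hη0 hη1)).add (C1Close.refl (ε := ε) hh hh0 hh1)
  have hMH : 0 ≤ M * H := mul_nonneg ((abs_nonneg _).trans hη0) hFG.nonneg.1
  have hl : 0 ≤ l * ε := (abs_nonneg _).trans hFG.abs_sub
  have hMl : 0 ≤ M * (l * ε) := mul_nonneg ((abs_nonneg _).trans hη0) hl
  exact ⟨key.diff_left, key.diff_right, key.abs_left.trans (by linarith),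
    key.abs_right.trans (by linarith), key.fderiv_left.trans (by linarith),
    key.fderiv_right.trans (by linarith), key.abs_sub.trans (by linarith),
    key.fderiv_sub.trans (by linarith)⟩

/-- The size of a net in terms of the exponents of the rate. -/
lemma log_card_net_le {C l Y : ℝ} {p m N c : ℕ} (hC : 1 ≤ C) (hl : 1 ≤ l) (hY : 1 ≤ Y)
    (hCl : 3 * C * l ≤ Y ^ p) (hm : 1 ≤ m) (hN : 1 ≤ N)
    (hc : c ≤ (⌊2 * C / (1 / (l * √N))⌋₊ + 1) ^ (2 * m)) :
    Real.log (2 * c) ≤ 2 * m * (p + 2) * Y * √N := by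
  have hN' : 1 ≤ √(N : ℝ) := Real.one_le_sqrt.2 (by exact_mod_cast hN)
  have hm' : (1 : ℝ) ≤ m := by exact_mod_cast hm
  have hYN : 1 ≤ Y * √N := one_le_mul_of_one_le_of_one_le hY hN'
  rcases Nat.eq_zero_or_pos c with rfl | hc0
  · simp; positivity
  have hc0' : (0 : ℝ) < c := by exact_mod_cast hc0
  have h1 : (c : ℝ) ≤ (Y ^ p * √N) ^ (2 * m) := by
    have hc' : (c : ℝ) ≤ ((⌊2 * C / (1 / (l * √N))⌋₊ : ℝ) + 1) ^ (2 * m) := by exact_mod_cast hc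
    refine hc'.trans (pow_le_pow_left₀ (by positivity) ?_ _)
    have hfl : (⌊2 * C / (1 / (l * √N))⌋₊ : ℝ) ≤ 2 * C / (1 / (l * √N)) :=
      Nat.floor_le (by positivity)
    have hone : 1 ≤ C * l * √N :=
      one_le_mul_of_one_le_of_one_le (one_le_mul_of_one_le_of_one_le hC hl) hN'
    have hdiv : 2 * C / (1 / (l * √N)) = 2 * (C * l * √N) := by field_simp
    -- The extra cell is absorbed by `1 ≤ C * l * √N`, which turns `2` into `3`.
    calc (⌊2 * C / (1 / (l * √N))⌋₊ : ℝ) + 1 ≤ 3 * C * l * √N := by linarith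
      _ ≤ _ := by gcongr
  have h2 : Real.log (2 * c) ≤ Real.log 2 + 2 * m * (p * Real.log Y + Real.log √N) := by
    rw [Real.log_mul two_ne_zero hc0'.ne']
    refine add_le_add le_rfl ((Real.log_le_log hc0' h1).trans (le_of_eq ?_))
    rw [Real.log_pow, Real.log_mul (by positivity) (by positivity), Real.log_pow]
    push_cast; ring
  -- The deliberate loss: a logarithm is replaced by `Y * √N`. After division by `N` and a square
  -- root this yields `√Y` and `N^(-1/4)`.
  have h3 : Real.log Y ≤ Y * √N := (Real.log_le_self (by linarith)).trans
    (le_mul_of_one_le_right (by linarith) hN')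
  have h4 : Real.log √N ≤ Y * √N := (Real.log_le_self (by linarith)).trans
    (le_mul_of_one_le_left (by linarith) hY)
  have h5 : Real.log 2 ≤ m * (Y * √N) :=
    Real.log_two_lt_d9.le.trans (le_trans (by norm_num) (one_le_mul_of_one_le_of_one_le hm' hYN))
  calc Real.log (2 * c) ≤ m * (Y * √N) + 2 * m * (p * (Y * √N) + Y * √N) := by
        refine h2.trans ?_
        gcongr
    _ ≤ _ := by nlinarith [mul_pos (by linarith : (0 : ℝ) < m) (by linarith : 0 < Y * √N)]

/-- Statistical error of an architecture whose networks are `C¹`-Lipschitz in the parameters. -/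
theorem statError_le {n : ℕ} {P : ObstacleProblem n} {M : ℝ} (hM : 1 ≤ M) (hP : P.Admissible)
    (hPM : P.BoundedBy M) {η h : E n → ℝ} (hη : ContDiffOn ℝ 1 η P.Ω) (hh : ContDiffOn ℝ 1 h P.Ω)
    (hηM : C1BoundedOn P.Ω M η) {T κ : Type} [Fintype κ] {net : T → E n → ℝ} {coord : T → κ → ℝ}
    {C H l Y : ℝ} (hC : 1 ≤ C) (hH : 1 ≤ H) (hl : 1 ≤ l) (hY : 1 ≤ Y)
    (hhH : C1BoundedOn P.Ω (M * H) h) (hnet : ∀ θ, ContDiff ℝ 1 (net θ))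
    (hclose : ∀ θ θ', (∀ k, |coord θ k| ≤ C) → (∀ k, |coord θ' k| ≤ C) → ∀ ε, 0 ≤ ε →
      (∀ k, |coord θ k - coord θ' k| ≤ ε) → ∀ x ∈ P.Ω, C1Close x ε H H l l (net θ) (net θ'))
    {p m N : ℕ} (hCl : 3 * C * l ≤ Y ^ p) (hm : 1 ≤ m) (hκ : Fintype.card κ = m) (hN : 1 ≤ N)
    {Θs Θt : Set T} (hs : ∀ θ ∈ Θs, ∀ k, |coord θ k| ≤ C) (ht : ∀ θ ∈ Θt, ∀ k, |coord θ k| ≤ C) :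
    AEMeasurable (fun x => P.statError (ansatz net Θs η h) (ansatz net Θt η h) x)
        (P.sampleLaw N) ∧
      ∫⁻ x, P.statError (ansatz net Θs η h) (ansatz net Θt η h) x ∂(P.sampleLaw N) ≤
        ENNReal.ofReal (700 * M ^ 6 * H ^ 2 * √(m * (p + 2) * Y) / (N : ℝ) ^ (1 / 4 : ℝ)) := by
  have hprob := hP.isProbabilityMeasure
  have hsmooth : ∀ θ, ContDiffOn ℝ 1 (fun x => net θ x * η x + h x) P.Ω := fun θ =>
    ((hnet θ).contDiffOn.mul hη).add hh
  refine ⟨hP.aemeasurable_statError ?_ ?_ N, ?_⟩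
  · rintro u ⟨θ, -, rfl⟩; exact hsmooth θ
  · rintro u ⟨θ, -, rfl⟩; exact hsmooth θ
  have hηd : ∀ x ∈ P.Ω, DifferentiableAt ℝ η x := fun x hx =>
    (hη.differentiableOn one_ne_zero).differentiableAt (hP.isOpen.mem_nhds hx)
  have hhd : ∀ x ∈ P.Ω, DifferentiableAt ℝ h x := fun x hx =>
    (hh.differentiableOn one_ne_zero).differentiableAt (hP.isOpen.mem_nhds hx)
  have hcl : ∀ θ θ', (∀ k, |coord θ k| ≤ C) → (∀ k, |coord θ' k| ≤ C) → ∀ ε, 0 ≤ ε →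
      (∀ k, |coord θ k - coord θ' k| ≤ ε) → ∀ x ∈ P.Ω,
      C1Close x (2 * M * l * ε) (3 * (M * H)) (3 * (M * H)) 1 1
        (fun x => net θ x * η x + h x) (fun x => net θ' x * η x + h x) := by
    intro θ θ' hθ hθ' ε hε hθθ x hx
    exact (hclose θ θ' hθ hθ' ε hε hθθ x hx).ansatz (hηd x hx) (hhd x hx) (hηM x hx).1
      (hηM x hx).2 (hhH x hx).1 (hhH x hx).2
  have hbd : ∀ θ, (∀ k, |coord θ k| ≤ C) →
      C1BoundedOn P.Ω (3 * (M * H)) (fun x => net θ x * η x + h x) := by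
    intro θ hθ x hx
    have := hcl θ θ hθ hθ 0 le_rfl (fun k => by simp) x hx
    exact ⟨this.abs_left, by rw [norm_gradient]; exact this.fderiv_left⟩
  have hMH : 1 ≤ 3 * (M * H) := by
    have := one_le_mul_of_one_le_of_one_le hM hH
    linarith
  let φ : Θs × Θt → E n → ℝ := fun i => P.integrand
    (fun x => net i.1 x * η x + h x) (fun x => net i.2 x * η x + h x)
  have hN' : 1 ≤ √(N : ℝ) := Real.one_le_sqrt.2 (by exact_mod_cast hN)
  -- Cancels `l` in the discretisation error, so that the Lipschitz constant enters only through the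
  -- size of the net.
  set ε : ℝ := 1 / (l * √N) with hε
  have hε0 : 0 < ε := by positivity
  -- The pair of networks is treated as one vector of `2 * m` parameters.
  obtain ⟨J, hJcard, hJ⟩ := exists_finset_net (I := Θs × Θt) (κ := κ ⊕ κ)
    (fun i => Sum.elim (coord i.1) (coord i.2)) (C := C) hε0
    (fun i k => by rcases k with k | k <;> simp [hs _ i.1.2 k, ht _ i.2.2 k])
  rw [Fintype.card_sum, hκ, ← two_mul] at hJcard
  set e : ℝ := 26 * M ^ 2 * (3 * (M * H)) * (2 * M * l * ε) with he
  have he0 : 0 ≤ e := by positivity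
  have hmain := lintegral_iSup_empirical_le hP.ae_mem φ
    (fun i => hP.aemeasurable (hP.continuousOn_integrand (hsmooth _) (hsmooth _)))
    (G := 18 * M ^ 3 * (3 * (M * H)) ^ 2) (by positivity)
    (fun i x hx => abs_integrand_le hP hPM hM hMH (hbd _ (hs _ i.1.2)) (hbd _ (ht _ i.2.2)) hx)
    J he0 (fun i => by
      obtain ⟨j, hj, hij⟩ := hJ i
      refine ⟨j, hj, fun x hx => abs_integrand_sub_le hP hPM hM hMH hx ?_ ?_⟩
      · exact hcl _ _ (hs _ i.1.2) (hs _ j.1.2) ε hε0.le (fun k => hij (Sum.inl k)) x hx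
      · exact hcl _ _ (ht _ i.2.2) (ht _ j.2.2) ε hε0.le (fun k => hij (Sum.inr k)) x hx) hN
  have hvol : 0 ≤ (volume P.Ω).toReal := ENNReal.toReal_nonneg
  have hstat : ∀ x : Fin N → E n, P.statError (ansatz net Θs η h) (ansatz net Θt η h) x ≤
      ENNReal.ofReal (volume P.Ω).toReal * ⨆ i, ENNReal.ofReal
        |∫ y, φ i y ∂(ProbabilityTheory.cond volume P.Ω) - (1 / N : ℝ) * ∑ k, φ i (x k)| := by
    intro x
    refine iSup₂_le fun u ⟨θ, hθ, hu⟩ => iSup₂_le fun v ⟨θ', hθ', hv⟩ => ?_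
    subst hu hv
    rw [hP.objective_eq hPM (hsmooth θ) (hsmooth θ') (hbd θ (hs θ hθ)) (hbd θ' (ht θ' hθ')),
      objectiveMC_eq, ← mul_sub, abs_mul, abs_of_nonneg hvol, ENNReal.ofReal_mul hvol]
    gcongr
    exact le_iSup (fun i => ENNReal.ofReal
      |∫ y, φ i y ∂(ProbabilityTheory.cond volume P.Ω) - (1 / N : ℝ) * ∑ k, φ i (x k)|)
      (⟨⟨θ, hθ⟩, ⟨θ', hθ'⟩⟩ : Θs × Θt)
  calc _ ≤ ∫⁻ x, ENNReal.ofReal (volume P.Ω).toReal * (⨆ i, ENNReal.ofReal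
        |∫ y, φ i y ∂(ProbabilityTheory.cond volume P.Ω) - (1 / N : ℝ) * ∑ k, φ i (x k)|)
          ∂(P.sampleLaw N) := lintegral_mono hstat
    _ = ENNReal.ofReal (volume P.Ω).toReal * ∫⁻ x, (⨆ i, ENNReal.ofReal
        |∫ y, φ i y ∂(ProbabilityTheory.cond volume P.Ω) - (1 / N : ℝ) * ∑ k, φ i (x k)|)
          ∂(P.sampleLaw N) := lintegral_const_mul' _ _ ENNReal.ofReal_ne_top
    _ ≤ ENNReal.ofReal (volume P.Ω).toReal * ENNReal.ofReal
          (2 * e + 18 * M ^ 3 * (3 * (M * H)) ^ 2 * √(2 * Real.log (2 * J.card) / N)) := by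
        gcongr
        exact hmain
    _ ≤ _ := by
        rw [← ENNReal.ofReal_mul hvol]
        refine ENNReal.ofReal_le_ofReal ?_
        have hNpos : (0 : ℝ) < N := by exact_mod_cast hN
        have hlog := log_card_net_le hC hl hY hCl hm hN hJcard
        set ρ : ℝ := (N : ℝ) ^ (1 / 4 : ℝ) with hρ
        have hρ1 : 1 ≤ ρ := Real.one_le_rpow (by exact_mod_cast hN) (by norm_num)
        have hρ4 : ρ ^ 4 = N := by
          rw [hρ, ← Real.rpow_natCast, ← Real.rpow_mul hNpos.le]; norm_num
        have hρ2 : √(N : ℝ) = ρ ^ 2 := by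
          rw [← hρ4, show ρ ^ 4 = (ρ ^ 2) ^ 2 by ring, Real.sqrt_sq (by positivity)]
        set Z : ℝ := m * (p + 2) * Y with hZ
        have hm' : (1 : ℝ) ≤ m := by exact_mod_cast hm
        have hZ1 : 1 ≤ Z := one_le_mul_of_one_le_of_one_le
          (one_le_mul_of_one_le_of_one_le hm' (by linarith [(Nat.cast_nonneg p : (0 : ℝ) ≤ p)])) hY
        have hsZ : 1 ≤ √Z := Real.one_le_sqrt.2 hZ1
        have h1 : √(2 * Real.log (2 * J.card) / N) ≤ 2 * √Z / ρ := by
          have : 2 * Real.log (2 * J.card) / N ≤ (2 / ρ) ^ 2 * Z := by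
            calc 2 * Real.log (2 * J.card) / N ≤ 2 * (2 * m * (p + 2) * Y * √N) / N := by gcongr
              _ = _ := by rw [hρ2, ← hρ4, hZ]; field_simp
          refine (Real.sqrt_le_sqrt this).trans (le_of_eq ?_)
          rw [Real.sqrt_mul (by positivity), Real.sqrt_sq (by positivity)]
          ring
        have h2 : e ≤ 156 * M ^ 5 * H ^ 2 * √Z / ρ := by
          have : e = 156 * M ^ 4 * H / ρ ^ 2 := by
            rw [he, hε, hρ2]; field_simp; ring
          rw [this]
          calc 156 * M ^ 4 * H / ρ ^ 2 ≤ 156 * M ^ 5 * H ^ 2 / ρ := by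
                gcongr
                · norm_num
                · exact le_self_pow₀ hH two_ne_zero
                · exact le_self_pow₀ hρ1 two_ne_zero
            _ ≤ _ := by
                exact div_le_div_of_nonneg_right
                  (le_mul_of_one_le_right (by positivity) hsZ) (by positivity)
        calc (volume P.Ω).toReal *
              (2 * e + 18 * M ^ 3 * (3 * (M * H)) ^ 2 * √(2 * Real.log (2 * J.card) / N))
            ≤ M * (2 * (156 * M ^ 5 * H ^ 2 * √Z / ρ) +
              18 * M ^ 3 * (3 * (M * H)) ^ 2 * (2 * √Z / ρ)) := by
              gcongr
              exact hPM.volume_le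
          -- Discretisation contributes `2 * 156`, fluctuation `18 * 9 * 2`.
          _ = 636 * (M ^ 6 * H ^ 2 * √Z / ρ) := by ring
          _ ≤ 700 * (M ^ 6 * H ^ 2 * √Z / ρ) := by gcongr; norm_num
          _ = _ := by ring

end ObstacleNN

namespace ObstacleNN

/-! ### The explicit rates -/

/-- Evaluates `√(m * (p + 2) * Y)` at `p = 9`: since `11 ≤ 16`, the constant is `4`, while `√m` and
`√M` are relaxed to `m` and `M`. -/
lemma sqrt_scale {M CΩ A : ℝ} {n m : ℕ} (hM : 1 ≤ M) (hCΩ : 1 ≤ CΩ) (hm : 1 ≤ m) {d : ℕ}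
    (hA : 0 ≤ A) :
    √(m * ((9 : ℕ) + 2) * (M * n * CΩ * A ^ (2 * d))) ≤ 4 * m * M * √n * √CΩ * A ^ d := by
  have hm' : (1 : ℝ) ≤ m := by exact_mod_cast hm
  refine Real.sqrt_le_iff.2 ⟨by positivity, ?_⟩
  have h1 : (4 * m * M * √n * √CΩ * A ^ d) ^ 2 = 16 * m ^ 2 * M ^ 2 * n * CΩ * A ^ (2 * d) := by
    rw [mul_pow, mul_pow, mul_pow, Real.sq_sqrt (by positivity), Real.sq_sqrt (by positivity)]
    ring
  rw [h1]
  calc m * ((9 : ℕ) + 2) * (M * n * CΩ * A ^ (2 * d))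
      = 11 * m * M * n * CΩ * A ^ (2 * d) := by push_cast; ring
    _ ≤ _ := by
      gcongr
      · norm_num
      · exact le_self_pow₀ hm' two_ne_zero
      · exact le_self_pow₀ hM two_ne_zero

lemma natCast_rpow_three_halves (n : ℕ) (hn : 1 ≤ n) : (n : ℝ) ^ (3 / 2 : ℝ) = n * √n := by
  have : (0 : ℝ) < n := by exact_mod_cast hn
  rw [show (3 / 2 : ℝ) = 1 + 1 / 2 by norm_num, Real.rpow_add this, Real.rpow_one, Real.sqrt_eq_rpow]

lemma one_le_sqrt_geom (k : ℕ) : 1 ≤ √(∑ j ∈ Finset.range (k + 1), (2 : ℝ) ^ j) := by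
  refine Real.one_le_sqrt.2 ?_
  rw [Finset.sum_range_succ']
  have : 0 ≤ ∑ j ∈ Finset.range k, (2 : ℝ) ^ (j + 1) := by positivity
  simpa using this

/-- The square of the `C¹` bound times `(2 * w * C) ^ d` has the exponents `3d`, `5d + 2`, `9d + 4`
of `2`, `w`, `C`, all below those of the rate up to a factor `2`. The geometric sum is only used to
be at least `1`. -/
lemma le_drrRate {n d w N : ℕ} {M C CΩ : ℝ} (hn : 1 ≤ n) (hd : 1 ≤ d) (hw : 1 ≤ w) (hM : 1 ≤ M)
    (hC : 1 ≤ C) (hCΩ : 1 ≤ CΩ) :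
    700 * M ^ 6 * (2 * M * √n * 2 ^ d * w ^ (2 * d + 1) * C ^ (4 * d + 2)) ^ 2 *
        √(drrParamCount n d w * ((9 : ℕ) + 2) * (M * n * CΩ * (2 * w * C) ^ (2 * d))) /
          (N : ℝ) ^ (1 / 4 : ℝ) ≤
      22400 * M ^ 9 * drrRate n d w C CΩ N := by
  have hW : (1 : ℝ) ≤ w := by exact_mod_cast hw
  have hm : 1 ≤ drrParamCount n d w := by simp [drrParamCount]
  have hsq := sqrt_scale (A := 2 * w * C) (n := n) (d := d) hM hCΩ hm (by positivity)
  set m := drrParamCount n d w with hm'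
  have h2 : (2 : ℝ) ^ (3 * d) ≤ 2 * (2 : ℝ) ^ ((9 * (d : ℝ) - 2) / 2) := by
    rw [← Real.rpow_natCast, ← Real.rpow_one_add' (by norm_num) (by
      have : (1 : ℝ) ≤ d := by exact_mod_cast hd
      linarith)]
    refine Real.rpow_le_rpow_of_exponent_le one_le_two ?_
    push_cast
    have : (1 : ℝ) ≤ d := by exact_mod_cast hd
    linarith
  rw [drrRate, ← mul_div_assoc, natCast_rpow_three_halves n hn, ← hm']
  refine div_le_div_of_nonneg_right ?_ (by positivity)
  calc 700 * M ^ 6 * (2 * M * √n * 2 ^ d * w ^ (2 * d + 1) * C ^ (4 * d + 2)) ^ 2 *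
        √(m * ((9 : ℕ) + 2) * (M * n * CΩ * (2 * w * C) ^ (2 * d)))
      ≤ 700 * M ^ 6 * (2 * M * √n * 2 ^ d * w ^ (2 * d + 1) * C ^ (4 * d + 2)) ^ 2 *
        (4 * m * M * √n * √CΩ * (2 * w * C) ^ d) := by gcongr
    _ = 700 * M ^ 6 * (4 * M ^ 2 * (√n) ^ 2 * (2 ^ d) ^ 2 * (w ^ (2 * d + 1)) ^ 2 *
          (C ^ (4 * d + 2)) ^ 2) * (4 * m * M * √n * √CΩ * (2 ^ d * w ^ d * C ^ d)) := by
        rw [mul_pow (2 * (w : ℝ)), mul_pow 2 (w : ℝ)]; ring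
    _ = 11200 * M ^ 9 * (n * √n * m * 1 * 2 ^ (3 * d) * w ^ (5 * d + 2) * C ^ (9 * d + 4) *
          √CΩ) := by
        rw [Real.sq_sqrt (by positivity)]; ring
    _ ≤ 11200 * M ^ 9 * (n * √n * m * √(∑ k ∈ Finset.range (2 * d + 1), (2 : ℝ) ^ k) *
          (2 * (2 : ℝ) ^ ((9 * (d : ℝ) - 2) / 2)) * w ^ (7 * d + 3) * C ^ (14 * d + 9) *
          √CΩ) := by
        gcongr
        · exact one_le_sqrt_geom _
        · omega
        · omega
        · omega
        · omega
    _ = _ := by ring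

lemma le_ffnRate {n d w N : ℕ} {M C CΩ : ℝ} (hn : 1 ≤ n) (hd : 1 ≤ d) (hw : 1 ≤ w) (hM : 1 ≤ M)
    (hC : 1 ≤ C) (hCΩ : 1 ≤ CΩ) :
    700 * M ^ 6 * (2 * √n * w ^ (d + 1) * C ^ (2 * d + 3)) ^ 2 *
        √(ffnParamCount n d w * ((9 : ℕ) + 2) * (M * n * CΩ * (2 * w * C) ^ (2 * d))) /
          (N : ℝ) ^ (1 / 4 : ℝ) ≤
      22400 * M ^ 9 * ffnRate n d w C CΩ N := by
  have hW : (1 : ℝ) ≤ w := by exact_mod_cast hw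
  have hd' : (1 : ℝ) ≤ d := by exact_mod_cast hd
  have hm : 1 ≤ ffnParamCount n d w := by simp [ffnParamCount]
  have hsq := sqrt_scale (A := 2 * w * C) (n := n) (d := d) hM hCΩ hm (by positivity)
  set m := ffnParamCount n d w with hm'
  have h2 : (2 : ℝ) ^ d ≤ 2 * (2 : ℝ) ^ ((9 * (d : ℝ) - 4) / 4) := by
    rw [← Real.rpow_natCast, ← Real.rpow_one_add' (by norm_num) (by linarith)]
    exact Real.rpow_le_rpow_of_exponent_le one_le_two (by linarith)
  have hw2 : (w : ℝ) ^ (3 * d + 2) ≤ (w : ℝ) ^ (7 * (d : ℝ) / 2 + 3) := by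
    rw [← Real.rpow_natCast]
    exact Real.rpow_le_rpow_of_exponent_le hW (by push_cast; linarith)
  rw [ffnRate, ← mul_div_assoc, natCast_rpow_three_halves n hn, ← hm']
  refine div_le_div_of_nonneg_right ?_ (by positivity)
  calc 700 * M ^ 6 * (2 * √n * w ^ (d + 1) * C ^ (2 * d + 3)) ^ 2 *
        √(m * ((9 : ℕ) + 2) * (M * n * CΩ * (2 * w * C) ^ (2 * d)))
      ≤ 700 * M ^ 6 * (2 * √n * w ^ (d + 1) * C ^ (2 * d + 3)) ^ 2 *
        (4 * m * M * √n * √CΩ * (2 * w * C) ^ d) := by gcongr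
    _ = 700 * M ^ 6 * (4 * (√n) ^ 2 * (w ^ (d + 1)) ^ 2 *
          (C ^ (2 * d + 3)) ^ 2) * (4 * m * M * √n * √CΩ * (2 ^ d * w ^ d * C ^ d)) := by
        rw [mul_pow (2 * (w : ℝ)), mul_pow 2 (w : ℝ)]; ring
    _ = 11200 * M ^ 7 * (n * √n * m * 1 * 2 ^ d * w ^ (3 * d + 2) * C ^ (5 * d + 6) *
          √CΩ) := by
        rw [Real.sq_sqrt (by positivity)]; ring
    _ ≤ 11200 * M ^ 9 * (n * √n * m * √(∑ k ∈ Finset.range (d + 1), (2 : ℝ) ^ k) *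
          (2 * (2 : ℝ) ^ ((9 * (d : ℝ) - 4) / 4)) * (w : ℝ) ^ (7 * (d : ℝ) / 2 + 3) *
          C ^ (7 * d + 9) * √CΩ) := by
        gcongr
        · norm_num
        · exact one_le_sqrt_geom _
        · omega
        · omega
    _ = _ := by ring

/-- The Lipschitz constant of residual networks is at most exponential in the depth. -/
lemma drr_lipschitz_le {n d w : ℕ} {M C CΩ : ℝ} (hn : 1 ≤ n) (hd : 1 ≤ d) (hw : 1 ≤ w) (hM : 1 ≤ M)
    (hC : 1 ≤ C) (hCΩ : 1 ≤ CΩ) :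
    3 * C * (3 * w * C ^ 2 * ((2 * M * √n * C) ^ 2 * (5 * (3 * w * C ^ 2) ^ 4) ^ d)) ≤
      (M * n * CΩ * (2 * w * C) ^ (2 * d)) ^ 9 := by
  have hW : (1 : ℝ) ≤ w := by exact_mod_cast hw
  have hn' : (1 : ℝ) ≤ n := by exact_mod_cast hn
  have h1 : (1 : ℝ) ≤ 36 * w * C ^ 5 := by
    have := one_le_mul_of_one_le_of_one_le hW (one_le_pow₀ (n := 5) hC)
    linarith
  -- Since `d ≥ 1`, the prefactor can be raised to the power `d` and merged with the block factor.
  -- The base `36 * 405 = 14580` lies below `262144 = 4 ^ 9`, the factor per block in the ninth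
  -- power.
  calc 3 * C * (3 * w * C ^ 2 * ((2 * M * √n * C) ^ 2 * (5 * (3 * w * C ^ 2) ^ 4) ^ d))
      = M ^ 2 * (√n) ^ 2 * 1 * (36 * w * C ^ 5 * (405 * w ^ 4 * C ^ 8) ^ d) := by
        rw [show 5 * (3 * w * C ^ 2) ^ 4 = 405 * (w : ℝ) ^ 4 * C ^ 8 by ring]; ring
    _ ≤ M ^ 9 * n ^ 9 * CΩ ^ 9 * ((36 * w * C ^ 5) ^ d * (405 * w ^ 4 * C ^ 8) ^ d) := by
        rw [Real.sq_sqrt (by positivity)]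
        gcongr
        · norm_num
        · exact le_self_pow₀ hn' (by norm_num)
        · exact one_le_pow₀ hCΩ
        · exact le_self_pow₀ h1 (by omega)
    _ = M ^ 9 * n ^ 9 * CΩ ^ 9 * (14580 * w ^ 5 * C ^ 13) ^ d := by
        rw [← mul_pow (36 * (w : ℝ) * C ^ 5)]; congr 2; ring
    _ ≤ M ^ 9 * n ^ 9 * CΩ ^ 9 * (262144 * w ^ 18 * C ^ 18) ^ d := by
        gcongr
        all_goals norm_num
    _ = _ := by
        rw [mul_pow (M * n * CΩ), ← pow_mul, show 2 * d * 9 = 18 * d by ring, pow_mul]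
        congr 1
        · ring
        · congr 1; ring

/-- The Lipschitz constant of feedforward networks is at most exponential in the depth. -/
lemma ffn_lipschitz_le {n d w : ℕ} {M C CΩ : ℝ} (hn : 1 ≤ n) (hd : 1 ≤ d) (hw : 1 ≤ w) (hM : 1 ≤ M)
    (hC : 1 ≤ C) (hCΩ : 1 ≤ CΩ) :
    3 * C * (3 * w * C ^ 2 * ((2 * √n * CΩ * C ^ 2) ^ 2 * (2 * (3 * w * C ^ 2) ^ 2) ^ d)) ≤
      (M * n * CΩ * (2 * w * C) ^ (2 * d)) ^ 9 := by
  have hW : (1 : ℝ) ≤ w := by exact_mod_cast hw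
  have hn' : (1 : ℝ) ≤ n := by exact_mod_cast hn
  have h1 : (1 : ℝ) ≤ 36 * w * C ^ 7 := by
    have := one_le_mul_of_one_le_of_one_le hW (one_le_pow₀ (n := 7) hC)
    linarith
  calc 3 * C * (3 * w * C ^ 2 * ((2 * √n * CΩ * C ^ 2) ^ 2 * (2 * (3 * w * C ^ 2) ^ 2) ^ d))
      = 1 * (√n) ^ 2 * CΩ ^ 2 * (36 * w * C ^ 7 * (18 * w ^ 2 * C ^ 4) ^ d) := by
        rw [show 2 * (3 * w * C ^ 2) ^ 2 = 18 * (w : ℝ) ^ 2 * C ^ 4 by ring]; ring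
    _ ≤ M ^ 9 * n ^ 9 * CΩ ^ 9 * ((36 * w * C ^ 7) ^ d * (18 * w ^ 2 * C ^ 4) ^ d) := by
        rw [Real.sq_sqrt (by positivity)]
        gcongr
        · exact one_le_pow₀ hM
        · exact le_self_pow₀ hn' (by norm_num)
        · norm_num
        · exact le_self_pow₀ h1 (by omega)
    _ = M ^ 9 * n ^ 9 * CΩ ^ 9 * (648 * w ^ 3 * C ^ 11) ^ d := by
        rw [← mul_pow (36 * (w : ℝ) * C ^ 7)]; congr 2; ring
    _ ≤ M ^ 9 * n ^ 9 * CΩ ^ 9 * (262144 * w ^ 18 * C ^ 18) ^ d := by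
        gcongr
        all_goals norm_num
    _ = _ := by
        rw [mul_pow (M * n * CΩ), ← pow_mul, show 2 * d * 9 = 18 * d by ring, pow_mul]
        congr 1
        · ring
        · congr 1; ring

/-- A lift of the boundary data that is bounded in `C¹`, or equal to a network that is. -/
lemma C1BoundedOn.of_or {n : ℕ} {Ω : Set (E n)} (hΩ : IsOpen Ω) {M H : ℝ} (hM : 1 ≤ M) (hH : 1 ≤ H)
    {h : E n → ℝ} {Q : (E n → ℝ) → Prop}
    (hh : C1BoundedOn Ω M h ∨ ∃ g, Q g ∧ Set.EqOn h g (closure Ω))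
    (hQ : ∀ g, Q g → C1BoundedOn Ω H g) : C1BoundedOn Ω (M * H) h := by
  have hMH : M ≤ M * H := le_mul_of_one_le_right (by linarith) hH
  have hHM : H ≤ M * H := le_mul_of_one_le_left (by linarith) hM
  rcases hh with hh | ⟨g, hg, hhg⟩
  · exact fun x hx => ⟨(hh x hx).1.trans hMH, (hh x hx).2.trans hMH⟩
  · intro x hx
    have heq : h =ᶠ[nhds x] g :=
      Filter.eventually_of_mem (hΩ.mem_nhds hx) fun y hy => hhg (subset_closure hy)
    rw [heq.eq_of_nhds, show ∇ h x = ∇ g x by rw [gradient, gradient, heq.fderiv_eq]]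
    exact ⟨(hQ g hg x hx).1.trans hHM, (hQ g hg x hx).2.trans hHM⟩

lemma C1Close.c1BoundedOn {n : ℕ} {Ω : Set (E n)} {ε b l₀ l₁ : ℝ} {F G : E n → ℝ}
    (h : ∀ x ∈ Ω, C1Close x ε b b l₀ l₁ F G) : C1BoundedOn Ω b F := fun x hx =>
  ⟨(h x hx).abs_left, by rw [norm_gradient]; exact (h x hx).fderiv_left⟩

lemma ObstacleProblem.BoundedBy.mono {n : ℕ} {P : ObstacleProblem n} {M M' : ℝ}
    (h : P.BoundedBy M) (hM : M ≤ M') : P.BoundedBy M' where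
  volume_le := h.volume_le.trans hM
  k_le := h.k_le.trans hM
  γ_inv_le := h.γ_inv_le.trans hM
  w₁_le := h.w₁_le.trans hM
  w₂_le := h.w₂_le.trans hM
  f_le x hx := (h.f_le x hx).trans hM
  ψ_le x hx := (h.ψ_le x hx).trans hM

lemma C1BoundedOn.mono {n : ℕ} {Ω : Set (E n)} {u : E n → ℝ} {M M' : ℝ}
    (h : C1BoundedOn Ω M u) (hM : M ≤ M') : C1BoundedOn Ω M' u :=
  fun x hx => ⟨(h x hx).1.trans hM, (h x hx).2.trans hM⟩

end ObstacleNN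

/-! ### The two architectures -/

theorem mainTheorem1 (M : ℝ) :
    ∃ K : ℝ, 0 < K ∧
      ∀ (n : ℕ), 1 ≤ n →
      ∀ (P : ObstacleNN.ObstacleProblem n), P.Admissible → P.BoundedBy M →
      ∀ (η h : ObstacleNN.E n → ℝ),
        ObstacleNN.IsC1Closure P.Ω η → (∀ x ∈ frontier P.Ω, η x = 0) →
        ObstacleNN.C1BoundedOn P.Ω M η → ObstacleNN.IsC1Closure P.Ω h →
      ∀ (CΩ : ℝ), 1 ≤ CΩ → (∀ x ∈ P.Ω, ‖x‖ ≤ CΩ) →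
      ∀ (σ : ℝ → ℝ) (L L' : ℝ≥0), ObstacleNN.IsActivation σ L L' →
      ∀ (d w N : ℕ) (B : ℝ), 1 ≤ d → 1 ≤ w → 1 ≤ N →
        -- residual networks
        ((∀ x ∈ P.Ω, ‖x‖ ≤ M) →
          (ObstacleNN.C1BoundedOn P.Ω M h ∨
            ∃ θ : ObstacleNN.DRRParam n d w, θ.BoundedBy B ∧ Set.EqOn h (θ.net σ) (closure P.Ω)) →
          ∀ Θs Θt : Set (ObstacleNN.DRRParam n d w),
            (∀ θ ∈ Θs, θ.BoundedBy B) → (∀ θ ∈ Θt, θ.BoundedBy B) →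
            AEMeasurable
              (fun x => P.statError
                (ObstacleNN.ansatz (fun θ => θ.net σ) Θs η h)
                (ObstacleNN.ansatz (fun θ => θ.net σ) Θt η h) x) (P.sampleLaw N) ∧
            ∫⁻ x, P.statError
                (ObstacleNN.ansatz (fun θ => θ.net σ) Θs η h)
                (ObstacleNN.ansatz (fun θ => θ.net σ) Θt η h) x ∂(P.sampleLaw N) ≤
              ENNReal.ofReal
                (K * ObstacleNN.drrRate n d w (ObstacleNN.cBar σ L L' B) CΩ N)) ∧
        -- feedforward networks
        ((ObstacleNN.C1BoundedOn P.Ω M h ∨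
            ∃ θ : ObstacleNN.FFNParam n d w, θ.BoundedBy B ∧ Set.EqOn h (θ.net σ) (closure P.Ω)) →
          ∀ Θs Θt : Set (ObstacleNN.FFNParam n d w),
            (∀ θ ∈ Θs, θ.BoundedBy B) → (∀ θ ∈ Θt, θ.BoundedBy B) →
            AEMeasurable
              (fun x => P.statError
                (ObstacleNN.ansatz (fun θ => θ.net σ) Θs η h)
                (ObstacleNN.ansatz (fun θ => θ.net σ) Θt η h) x) (P.sampleLaw N) ∧
            ∫⁻ x, P.statError
                (ObstacleNN.ansatz (fun θ => θ.net σ) Θs η h)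
                (ObstacleNN.ansatz (fun θ => θ.net σ) Θt η h) x ∂(P.sampleLaw N) ≤
              ENNReal.ofReal
                (K * ObstacleNN.ffnRate n d w (ObstacleNN.cBar σ L L' B) CΩ N)) := by
  -- Makes powers of the bound monotone in the exponent; the constant still depends on `M` alone.
  set M' := max M 1 with hM'
  have hM1 : 1 ≤ M' := le_max_right _ _
  have hMM : M ≤ M' := le_max_left _ _
  refine ⟨22400 * M' ^ 9, by positivity, ?_⟩
  intro n hn P hP hPM η h hη _ hηM hh CΩ hCΩ hΩ σ L L' hσ d w N B hd hw hN
  have hC : 1 ≤ ObstacleNN.cBar σ L L' B := ObstacleNN.one_le_cBar σ L L' B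
  have hB : B ≤ ObstacleNN.cBar σ L L' B := ObstacleNN.le_cBar σ L L' B
  have hact := hσ.activationBound B
  set C := ObstacleNN.cBar σ L L' B with hCdef
  have hW : (1 : ℝ) ≤ w := by exact_mod_cast hw
  have hn1 : (1 : ℝ) ≤ n := by exact_mod_cast hn
  have hn' : (1 : ℝ) ≤ √n := Real.one_le_sqrt.2 hn1
  have hY : 1 ≤ M' * n * CΩ * (2 * w * C) ^ (2 * d) := by
    have h1 := one_le_mul_of_one_le_of_one_le hW hC
    exact one_le_mul_of_one_le_of_one_le (one_le_mul_of_one_le_of_one_le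
      (one_le_mul_of_one_le_of_one_le hM1 hn1) hCΩ) (one_le_pow₀ (by linarith))
  have hWC2 : (1 : ℝ) ≤ 3 * w * C ^ 2 := by
    have := one_le_mul_of_one_le_of_one_le hW (one_le_pow₀ (n := 2) hC)
    linarith
  have hsq : ∀ t : ℝ, 1 ≤ t → ∀ k : ℕ, 1 ≤ t ^ k := fun t ht k => one_le_pow₀ ht
  refine ⟨fun hxM hor Θs Θt hs ht => ?_, fun hor Θs Θt hs ht => ?_⟩
  · set H := 2 * M' * √n * 2 ^ d * w ^ (2 * d + 1) * C ^ (4 * d + 2) with hHdef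
    set l := 3 * w * C ^ 2 * ((2 * M' * √n * C) ^ 2 * (5 * (3 * w * C ^ 2) ^ 4) ^ d) with hldef
    have hMn : 1 ≤ M' * √n := one_le_mul_of_one_le_of_one_le hM1 hn'
    have hH : 1 ≤ H := one_le_mul_of_one_le_of_one_le (one_le_mul_of_one_le_of_one_le
      (one_le_mul_of_one_le_of_one_le (by linarith) (hsq 2 one_le_two d)) (hsq _ hW _)) (hsq _ hC _)
    have hl : 1 ≤ l := one_le_mul_of_one_le_of_one_le hWC2 (one_le_mul_of_one_le_of_one_le
      (hsq _ (one_le_mul_of_one_le_of_one_le (by linarith) hC) _)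
      (hsq _ (by linarith [hsq _ hWC2 4]) _))
    have hclose : ∀ θ θ' : ObstacleNN.DRRParam n d w, (∀ k, |θ.coord k| ≤ C) →
        (∀ k, |θ'.coord k| ≤ C) → ∀ ε, 0 ≤ ε → (∀ k, |θ.coord k - θ'.coord k| ≤ ε) →
        ∀ x ∈ P.Ω, ObstacleNN.C1Close x ε H H l l (θ.net σ) (θ'.net σ) :=
      fun θ θ' hθ hθ' ε hε hθθ x hx => ObstacleNN.DRRParam.c1Close_net hn hd hw hact hC hM1 hε
        hθ hθ' hθθ ((hxM x hx).trans hMM)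
    have hhH : ObstacleNN.C1BoundedOn P.Ω (M' * H) h := by
      refine ObstacleNN.C1BoundedOn.of_or hP.isOpen hM1 hH
        (Q := fun g => ∃ θ : ObstacleNN.DRRParam n d w, θ.BoundedBy B ∧ g = θ.net σ)
        (hor.imp (fun hb => hb.mono hMM) fun ⟨θ, hθ, he⟩ => ⟨_, ⟨θ, hθ, rfl⟩, he⟩) ?_
      rintro g ⟨θ, hθ, rfl⟩
      have hθC := fun k => ((θ.boundedBy_iff B).1 hθ k).trans hB
      -- Comparing a network with itself at `ε = 0` yields its `C¹` bound, so a lift given by a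
      -- network needs no bound from `M`.
      exact ObstacleNN.C1Close.c1BoundedOn
        (hclose θ θ hθC hθC 0 le_rfl fun k => by simp)
    have key := ObstacleNN.statError_le hM1 hP (hPM.mono hMM) hη.2.1 hh.2.1 (hηM.mono hMM)
      (net := fun θ : ObstacleNN.DRRParam n d w => θ.net σ) (coord := ObstacleNN.DRRParam.coord)
      hC hH hl hY hhH (fun θ => θ.contDiff_net hσ.contDiff) hclose
      (ObstacleNN.drr_lipschitz_le hn hd hw hM1 hC hCΩ) (by simp [ObstacleNN.drrParamCount])
      (ObstacleNN.DRRParam.card_coord n d w) hN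
      (fun θ hθ k => ((θ.boundedBy_iff B).1 (hs θ hθ) k).trans hB)
      (fun θ hθ k => ((θ.boundedBy_iff B).1 (ht θ hθ) k).trans hB)
    exact ⟨key.1, key.2.trans (ENNReal.ofReal_le_ofReal
      (ObstacleNN.le_drrRate hn hd hw hM1 hC hCΩ))⟩
  · set H := 2 * √n * w ^ (d + 1) * C ^ (2 * d + 3) with hHdef
    set l := 3 * w * C ^ 2 * ((2 * √n * CΩ * C ^ 2) ^ 2 * (2 * (3 * w * C ^ 2) ^ 2) ^ d) with hldef
    have hnC : 1 ≤ √n * CΩ := one_le_mul_of_one_le_of_one_le hn' hCΩ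
    have hH : 1 ≤ H := one_le_mul_of_one_le_of_one_le (one_le_mul_of_one_le_of_one_le
      (by linarith) (hsq _ hW _)) (hsq _ hC _)
    have hl : 1 ≤ l := one_le_mul_of_one_le_of_one_le hWC2 (one_le_mul_of_one_le_of_one_le
      (hsq _ (one_le_mul_of_one_le_of_one_le (by linarith) (hsq _ hC _)) _)
      (hsq _ (by linarith [hsq _ hWC2 2]) _))
    have hclose : ∀ θ θ' : ObstacleNN.FFNParam n d w, (∀ k, |θ.coord k| ≤ C) →
        (∀ k, |θ'.coord k| ≤ C) → ∀ ε, 0 ≤ ε → (∀ k, |θ.coord k - θ'.coord k| ≤ ε) →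
        ∀ x ∈ P.Ω, ObstacleNN.C1Close x ε H H l l (θ.net σ) (θ'.net σ) :=
      fun θ θ' hθ hθ' ε hε hθθ x hx => ObstacleNN.FFNParam.c1Close_net hn hw hact hC hCΩ hε
        hθ hθ' hθθ (hΩ x hx)
    have hhH : ObstacleNN.C1BoundedOn P.Ω (M' * H) h := by
      refine ObstacleNN.C1BoundedOn.of_or hP.isOpen hM1 hH
        (Q := fun g => ∃ θ : ObstacleNN.FFNParam n d w, θ.BoundedBy B ∧ g = θ.net σ)
        (hor.imp (fun hb => hb.mono hMM) fun ⟨θ, hθ, he⟩ => ⟨_, ⟨θ, hθ, rfl⟩, he⟩) ?_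
      rintro g ⟨θ, hθ, rfl⟩
      have hθC := fun k => ((θ.boundedBy_iff B).1 hθ k).trans hB
      exact ObstacleNN.C1Close.c1BoundedOn
        (hclose θ θ hθC hθC 0 le_rfl fun k => by simp)
    have key := ObstacleNN.statError_le hM1 hP (hPM.mono hMM) hη.2.1 hh.2.1 (hηM.mono hMM)
      (net := fun θ : ObstacleNN.FFNParam n d w => θ.net σ) (coord := ObstacleNN.FFNParam.coord)
      hC hH hl hY hhH (fun θ => θ.contDiff_net hσ.contDiff) hclose
      (ObstacleNN.ffn_lipschitz_le hn hd hw hM1 hC hCΩ) (by simp [ObstacleNN.ffnParamCount])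
      (ObstacleNN.FFNParam.card_coord n d w) hN
      (fun θ hθ k => ((θ.boundedBy_iff B).1 (hs θ hθ) k).trans hB)
      (fun θ hθ k => ((θ.boundedBy_iff B).1 (ht θ hθ) k).trans hB)
    exact ⟨key.1, key.2.trans (ENNReal.ofReal_le_ofReal
      (ObstacleNN.le_ffnRate hn hd hw hM1 hC hCΩ))⟩
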